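/- For integers $n,d\ge 0$ let $\Gamma_n^d$ be the set of $(0,1)$-matrices of order $n$ in which every row has exactly $d$ non-zero entries and these form a contiguous block, and let $$M_n^d=\{A\in\Gamma_n^d : \operatorname{per}(A)\ge \operatorname{per}(B)\ \text{for all } B\in\Gamma_n^d\}.$$ Write $A\cong B$ if $B$ arises from $A$ by permuting rows and permuting columns, let $1_{d\times d}$ be the all-ones matrix of order $d$, and for a square $(0,1)$-matrix $C$ let $G(C)$ be the bipartite graph on its rows and columns in which row $i$ is joined to column $j$ iff $c_{i,j}=1$. A square matrix of order $m \ge 1$ is fully indecomposable if it has no non-empty $r\times s$ zero submatrix with $r+s\ge m$. If $A\cong C_1\oplus\dots\oplus C_k$ with square matrices $C_i$, the $C_i$ are called the components of $A$ if every $C_i$ is fully indecomposable, and the connected components of $A$ if every $G(C_i)$ is connected. **Theorem.** For each integer $d\ge 0$ there exists $b_d$ such that for every $n$ and every $A\in M_n^d$, every component of $A$, and likewise every connected component of $A$, that does not contain $1_{d\times d}$ as a submatrix (on any $d$ rows and any $d$ columns) has order at most $b_d$. -/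

import Mathlib

namespace ContigPerm

/-- `Γ_n^d`: the `(0,1)`-matrices of order `n` in which every row has exactly `d` non-zero
entries, forming a contiguous block (occupying the columns `x, …, x + d - 1`). -/
def Gamma (n d : ℕ) : Set (Matrix (Fin n) (Fin n) ℕ) :=
  {A | ∀ i, ∃ x : ℕ, x + d ≤ n ∧
    ∀ j : Fin n, A i j = if x ≤ (j : ℕ) ∧ (j : ℕ) < x + d then 1 else 0}

/-- `M_n^d`: the members of `Γ_n^d` with maximum permanent. -/
def Maximizing (n d : ℕ) : Set (Matrix (Fin n) (Fin n) ℕ) :=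
  {A | A ∈ Gamma n d ∧ ∀ B ∈ Gamma n d, B.permanent ≤ A.permanent}

/-- `C` contains the all-ones matrix `1_{d×d}` as a submatrix: there are `d` distinct rows and
`d` distinct columns of `C` at whose intersections all entries are `1`. -/
def ContainsOnes (d : ℕ) {m : ℕ} (C : Matrix (Fin m) (Fin m) ℕ) : Prop :=
  ∃ (r c : Fin d ↪ Fin m), ∀ a b, C (r a) (c b) = 1

/-- A square matrix of positive order `m` is fully indecomposable if it has no non-empty
`r × s` zero submatrix with `r + s ≥ m`. (For `m ≥ 2` this is the same as excluding `r + s = m`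
only; a matrix of order `1` is fully indecomposable iff its entry is non-zero.) -/
def FullyIndecomposable {m : ℕ} (C : Matrix (Fin m) (Fin m) ℕ) : Prop :=
  0 < m ∧ ∀ R S : Finset (Fin m), R.Nonempty → S.Nonempty →
    (∀ i ∈ R, ∀ j ∈ S, C i j = 0) → R.card + S.card < m

/-- The bipartite graph `G(C)` of a `(0,1)`-matrix: the left vertices are the rows, the right
vertices the columns, and row `i` is joined to column `j` iff the `(i,j)` entry is `1`. -/
def bipGraph {m : ℕ} (C : Matrix (Fin m) (Fin m) ℕ) : SimpleGraph (Fin m ⊕ Fin m) :=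
  SimpleGraph.fromRel fun v w => ∃ i j, v = Sum.inl i ∧ w = Sum.inr j ∧ C i j = 1

/-- `A ≅ C_1 ⊕ ⋯ ⊕ C_k`: after a permutation of the rows and a permutation of the columns, `A`
is the block diagonal matrix with the square diagonal blocks `C_i` of order `m i`. -/
def IsDirectSum {n k : ℕ} (A : Matrix (Fin n) (Fin n) ℕ) (m : Fin k → ℕ)
    (C : ∀ i, Matrix (Fin (m i)) (Fin (m i)) ℕ) : Prop :=
  ∃ e f : (Σ i, Fin (m i)) ≃ Fin n, A.submatrix e f = Matrix.blockDiagonal' C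

/-- `C_1, …, C_k` are the (fully indecomposable) components of `A`. -/
def IsComponents {n k : ℕ} (A : Matrix (Fin n) (Fin n) ℕ) (m : Fin k → ℕ)
    (C : ∀ i, Matrix (Fin (m i)) (Fin (m i)) ℕ) : Prop :=
  IsDirectSum A m C ∧ ∀ i, FullyIndecomposable (C i)

/-- `C_1, …, C_k` are the connected components of `A`: the graphs `G(C_i)` are connected. -/
def IsConnectedComponents {n k : ℕ} (A : Matrix (Fin n) (Fin n) ℕ) (m : Fin k → ℕ)
    (C : ∀ i, Matrix (Fin (m i)) (Fin (m i)) ℕ) : Prop :=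
  IsDirectSum A m C ∧ ∀ i, (bipGraph (C i)).Connected

end ContigPerm

set_option linter.unusedSectionVars false

namespace ContigPerm

/-! By Bregman's inequality every member of `Γ_n^d` has permanent at most `(d!)^(n/d)`, and blocks
`1_{d×d}` along the diagonal, suitably completed, already give `(d!)^⌊n/d⌋`. A maximizer thus lies
within the constant factor `d!` of Bregman's bound. It suffices that a component without `1_{d×d}`
loses a factor `θ < 1` in Bregman's bound boundedly many columns apart: a large component then loses
more than `d!`.

The loss is local. Expanding along row `i` and bounding each minor by Bregman multiplies the bound
by the sum of `colWeight d c` over the columns through `i`, where `c` is the column sum; the value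
at `c = d` is `1/d`. By `mul_colWeight_lt`, `c * colWeight d c` lies strictly below its tangent at
`c = d` for `c ≠ d`. Summed over a long window the linear terms contribute only a boundary error, so
if columns with `c ≠ d` have positive density, some row has total weight below 1 (`LightRow`).
Otherwise some row meets only columns of sum `d`; if its block occurs fewer than `d` times, its
first and last columns do not share all their rows (`SkewRow`), and a second expansion, along one of
them, gains by `exists_mixedWeight_le`.

`exists_light_or_skew_row` finds such rows and `subPer_le_pow_mul` multiplies the gains of rows that
are far apart. The columns of a connected component are consecutive, and no block inside them is
repeated `d` times unless the component contains `1_{d×d}` (`exists_window`). Fully indecomposable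
components are connected, so one bound serves both claims. -/

/-! ### Estimates for the increments of `log (r!) / r` -/

/-- The logarithm of `(r!)^(1/r)`, with value `0` at `r = 0`. -/
noncomputable def logRoot (r : ℕ) : ℝ := Real.log (r.factorial : ℝ) / r

/-- The increments of `logRoot`. -/
noncomputable def rootStep (r : ℕ) : ℝ := logRoot r - logRoot (r - 1)

lemma mul_logRoot (r : ℕ) : (r : ℝ) * logRoot r = Real.log (r.factorial : ℝ) := by
  rcases Nat.eq_zero_or_pos r with rfl | h
  · simp [logRoot]
  · have : (r : ℝ) ≠ 0 := by positivity
    unfold logRoot; field_simp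

lemma log_factorial_succ (r : ℕ) :
    Real.log ((r + 1).factorial : ℝ) = Real.log (r + 1 : ℝ) + Real.log (r.factorial : ℝ) := by
  rw [Nat.factorial_succ, Nat.cast_mul, Real.log_mul (by positivity) (by positivity)]
  push_cast; ring

lemma succ_mul_rootStep (r : ℕ) :
    (r + 1 : ℝ) * rootStep (r + 1) = Real.log (r + 1 : ℝ) - logRoot r := by
  have h1 := mul_logRoot (r + 1)
  have h2 := mul_logRoot r
  rw [log_factorial_succ] at h1
  push_cast at h1
  simp only [rootStep, Nat.add_sub_cancel]
  linarith

lemma mul_rootStep {r : ℕ} (hr : 1 ≤ r) :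
    (r : ℝ) * rootStep r = Real.log r - logRoot (r - 1) := by
  obtain ⟨s, rfl⟩ := Nat.exists_eq_add_of_le' hr
  simpa using succ_mul_rootStep s

lemma rootStep_recurrence {r : ℕ} (hr : 1 ≤ r) :
    (r + 1 : ℝ) * rootStep (r + 1) = (r - 1) * rootStep r + Real.log (1 + 1 / (r : ℝ)) := by
  have h0 : (0 : ℝ) < r := by exact_mod_cast hr
  have h1 := succ_mul_rootStep r
  have h2 := mul_rootStep hr
  have h3 : Real.log (1 + 1 / (r : ℝ)) = Real.log (r + 1 : ℝ) - Real.log r := by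
    rw [← Real.log_div (by positivity) (by positivity)]
    congr 1; field_simp
  have h4 : rootStep r = logRoot r - logRoot (r - 1) := rfl
  linarith

lemma rootStep_one : rootStep 1 = 0 := by simp [rootStep, logRoot]

/-- Concavity of `log`: `1 + 1/(r+1)` is the mean of `1 + 1/r` and `1` with weights `r/(r+1)` and
`1/(r+1)`. -/
lemma mul_log_one_add_inv_le {r : ℕ} (hr : 1 ≤ r) :
    (r : ℝ) * Real.log (1 + 1 / (r : ℝ)) ≤ (r + 1 : ℝ) * Real.log (1 + 1 / (r + 1 : ℝ)) := by
  have h0 : (0 : ℝ) < r := by exact_mod_cast hr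
  have h := strictConcaveOn_log_Ioi.concaveOn.2
    (show (1 + 1 / (r : ℝ)) ∈ Set.Ioi (0 : ℝ) from by simp; positivity)
    (show (1 : ℝ) ∈ Set.Ioi (0 : ℝ) by simp)
    (show 0 ≤ (r : ℝ) / (r + 1) by positivity) (show 0 ≤ 1 / (r + 1 : ℝ) by positivity)
    (by field_simp)
  have e : (r : ℝ) / (r + 1) * (1 + 1 / (r : ℝ)) + 1 / (r + 1 : ℝ) * 1 = 1 + 1 / (r + 1 : ℝ) := by
    field_simp
  simp only [smul_eq_mul, Real.log_one, mul_zero, add_zero] at h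
  rw [e] at h
  have := mul_le_mul_of_nonneg_left h (show (0 : ℝ) ≤ r + 1 by positivity)
  calc _ = (r + 1 : ℝ) * (r / (r + 1) * Real.log (1 + 1 / (r : ℝ))) := by field_simp
    _ ≤ _ := this

lemma log_one_add_inv_pos {r : ℕ} (hr : 1 ≤ r) : 0 < Real.log (1 + 1 / (r : ℝ)) := by
  have h0 : (0 : ℝ) < r := by exact_mod_cast hr
  apply Real.log_pos; simp [h0]

/-- Induction through `rootStep_recurrence`; the upper bound is preserved because `r * log (1 +
1/r)` increases with `r`. -/
lemma rootStep_bounds {r : ℕ} (hr : 1 ≤ r) :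
    0 ≤ rootStep r ∧ rootStep r ≤ Real.log (1 + 1 / (r : ℝ)) := by
  induction r, hr using Nat.le_induction with
  | base => rw [rootStep_one]; exact ⟨le_rfl, (log_one_add_inv_pos le_rfl).le⟩
  | succ r hr ih =>
    have h1 := rootStep_recurrence hr
    have h2 := mul_log_one_add_inv_le hr
    have h3 := log_one_add_inv_pos hr
    have h0 : (1 : ℝ) ≤ r := by exact_mod_cast hr
    push_cast
    constructor
    · by_contra hc
      nlinarith [mul_nonneg (sub_nonneg.2 h0) ih.1]
    · have : (r - 1 : ℝ) * rootStep r ≤ (r - 1) * Real.log (1 + 1 / (r : ℝ)) :=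
        mul_le_mul_of_nonneg_left ih.2 (by linarith)
      have : (r + 1 : ℝ) * rootStep (r + 1) ≤ (r + 1) * Real.log (1 + 1 / (r + 1 : ℝ)) := by
        linarith
      exact le_of_mul_le_mul_left this (by positivity)

lemma rootStep_pos {r : ℕ} (hr : 2 ≤ r) : 0 < rootStep r := by
  obtain ⟨s, rfl⟩ := Nat.exists_eq_add_of_le' (show 1 ≤ r by omega)
  have hs : 1 ≤ s := by omega
  have h1 := rootStep_recurrence hs
  have h3 := log_one_add_inv_pos hs
  have h0 : (1 : ℝ) ≤ s := by exact_mod_cast hs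
  have := mul_nonneg (sub_nonneg.2 h0) (rootStep_bounds hs).1
  by_contra hc
  nlinarith

lemma mul_log_one_add_inv_lt_one {r : ℕ} (hr : 1 ≤ r) :
    (r : ℝ) * Real.log (1 + 1 / (r : ℝ)) < 1 := by
  have h0 : (0 : ℝ) < r := by exact_mod_cast hr
  have : Real.log (1 + 1 / (r : ℝ)) < 1 + 1 / (r : ℝ) - 1 :=
    Real.log_lt_sub_one_of_pos (by positivity) (by simp [h0.ne'])
  calc _ < (r : ℝ) * (1 + 1 / (r : ℝ) - 1) := mul_lt_mul_of_pos_left this h0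
    _ = 1 := by field_simp; ring

lemma exp_neg_mul_rootStep {d : ℕ} (hd : 1 ≤ d) :
    Real.exp (-(d * rootStep d) - logRoot (d - 1)) = 1 / d := by
  have h0 : (0 : ℝ) < d := by exact_mod_cast hd
  rw [mul_rootStep hd, show -(Real.log d - logRoot (d - 1)) - logRoot (d - 1) = -Real.log d by ring,
    Real.exp_neg, Real.exp_log h0, one_div]

/-! ### Weights of row and column expansions -/

/-- The weight of one row of an expansion along a row through a column with `c` ones, in a matrix
with row sums `d`, relative to the bound `∏ (d!)^(1/d)`. -/
noncomputable def colWeight (d c : ℕ) : ℝ := Real.exp (-(c * rootStep d) - logRoot (d - 1))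

lemma colWeight_self {d : ℕ} (hd : 1 ≤ d) : colWeight d d = 1 / d := exp_neg_mul_rootStep hd

/-- With `t = c - d` and `u = rootStep d` the left side is `exp (-u t) (1 + t/d)`, and the right
side is its tangent at `t = 0`. The inequality follows from `1 + u t < exp (u t)` and `(1 + u t)(1 +
(1/d - u) t) = 1 + t/d + u (1/d - u) t²`, as `0 < u < 1/d`. -/
lemma mul_colWeight_lt {d c : ℕ} (hd : 2 ≤ d) (hc : c ≠ d) :
    c * colWeight d c < 1 + (1 / d - rootStep d) * ((c : ℝ) - d) := by
  have h0 : (0 : ℝ) < d := by positivity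
  have hu := rootStep_pos hd
  have hub := (rootStep_bounds (show 1 ≤ d by omega)).2
  have hl := mul_log_one_add_inv_lt_one (show 1 ≤ d by omega)
  set u := rootStep d with hudef
  have hdu : d * u < 1 := lt_of_le_of_lt (mul_le_mul_of_nonneg_left hub h0.le) hl
  set t : ℝ := (c : ℝ) - d with ht
  have ht0 : t ≠ 0 := by
    rw [ht, sub_ne_zero]; exact_mod_cast hc
  have hw : colWeight d c = Real.exp (-(u * t)) * (1 / d) := by
    rw [← exp_neg_mul_rootStep (show 1 ≤ d by omega), ← Real.exp_add, colWeight]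
    congr 1; rw [ht]; ring
  have htd : -(d : ℝ) ≤ t := by rw [ht]; linarith [show (0 : ℝ) ≤ c by positivity]
  have hud : u < 1 / d := by rw [lt_div_iff₀ h0]; linarith
  have hpos : 0 < 1 + (1 / d - u) * t := by
    have h1 : (1 / d - u) * (-(d : ℝ)) ≤ (1 / d - u) * t :=
      mul_le_mul_of_nonneg_left htd (by linarith)
    have h2 : (1 / d - u) * (-(d : ℝ)) = -1 + d * u := by field_simp; ring
    have : 0 < d * u := by positivity
    linarith
  have he : u * t + 1 < Real.exp (u * t) := Real.add_one_lt_exp (mul_ne_zero hu.ne' ht0)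
  have key : 1 + t / d < Real.exp (u * t) * (1 + (1 / d - u) * t) := by
    have h1 := mul_lt_mul_of_pos_right he hpos
    have h2 : 1 + t / d ≤ (u * t + 1) * (1 + (1 / d - u) * t) := by
      have : 0 ≤ u * (1 / d - u) * t ^ 2 := by
        have := mul_nonneg hu.le (sub_pos.2 hud).le
        positivity
      have e : (u * t + 1) * (1 + (1 / d - u) * t) = 1 + t / d + u * (1 / d - u) * t ^ 2 := by
        ring
      linarith
    linarith
  have hcd : (c : ℝ) * (1 / d) = 1 + t / d := by rw [ht]; field_simp; ring
  have hee : Real.exp (-(u * t)) * Real.exp (u * t) = 1 := by rw [← Real.exp_add]; simp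
  rw [hw]
  calc (c : ℝ) * (Real.exp (-(u * t)) * (1 / d)) = Real.exp (-(u * t)) * (1 + t / d) := by
        rw [← hcd]; ring
    _ < Real.exp (-(u * t)) * (Real.exp (u * t) * (1 + (1 / d - u) * t)) :=
        mul_lt_mul_of_pos_left key (Real.exp_pos _)
    _ = _ := by rw [← mul_assoc, hee, one_mul]

/-- The weight of an expansion along a column with `D` ones, `N` of them in rows with sum `D` and
the others in rows with sum `D + 1`. -/
noncomputable def mixedWeight (D N : ℕ) : ℝ :=
  Real.exp (-(N * rootStep D) - ((D - N : ℕ) : ℝ) * rootStep (D + 1)) *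
    (N * Real.exp (-logRoot (D - 1)) + ((D - N : ℕ) : ℝ) * Real.exp (-logRoot D))

/-- This is what makes `mixedWeight D N` less than 1 for `N < D`: replacing a row sum `D` by `D + 1`
changes the exponent by less than the expansion terms lose. -/
lemma rootStep_drop_lt {D : ℕ} (hD : 1 ≤ D) :
    rootStep D - rootStep (D + 1) < (1 - Real.exp (-rootStep D)) / D := by
  have h0 : (0 : ℝ) < D := by exact_mod_cast hD
  have hb := rootStep_bounds hD
  have hl := mul_log_one_add_inv_lt_one hD
  have hl0 := log_one_add_inv_pos hD
  have hrec := rootStep_recurrence hD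
  have hel : Real.exp (-Real.log (1 + 1 / (D : ℝ))) = 1 - 1 / (D + 1) := by
    rw [Real.exp_neg, Real.exp_log (by positivity)]; field_simp; ring
  set l := Real.log (1 + 1 / (D : ℝ)) with hldef
  set u := rootStep D with hudef
  -- Chord of `exp` over `[-l, 0]`, whose left end has the rational value `exp (-l) = 1 - 1/(D+1)`.
  have hchord : Real.exp (-u) ≤ 1 - u / (l * (D + 1)) := by
    have h := convexOn_exp.2 (Set.mem_univ (-l)) (Set.mem_univ (0 : ℝ))
      (show 0 ≤ u / l from div_nonneg hb.1 hl0.le)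
      (show 0 ≤ 1 - u / l by rw [sub_nonneg, div_le_one hl0]; exact hb.2) (by ring)
    simp only [smul_eq_mul, mul_zero, add_zero, Real.exp_zero, mul_one] at h
    have e : u / l * -l = -u := by field_simp
    rw [e, hel] at h
    calc _ ≤ _ := h
      _ = _ := by field_simp; ring
  have hv : (D + 1 : ℝ) * (u - rootStep (D + 1)) = 2 * u - l := by linarith
  rw [lt_div_iff₀ h0]
  have h1 : D * (2 * u - l) < u / l := by
    rw [lt_div_iff₀ hl0]
    rcases hb.1.eq_or_lt with h | h
    · rw [← h]; nlinarith [mul_pos h0 (mul_pos hl0 hl0)]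
    · have h2 : D * (2 * u - l) * l ≤ D * u * l := by
        apply mul_le_mul_of_nonneg_right _ hl0.le
        apply mul_le_mul_of_nonneg_left _ h0.le
        linarith [hb.2]
      have h3 : D * u * l = (D * l) * u := by ring
      have : (D * l) * u < 1 * u := mul_lt_mul_of_pos_right hl h
      linarith
  have h2 : u / (l * (D + 1)) ≤ 1 - Real.exp (-u) := by linarith
  refine lt_of_lt_of_le ?_ h2
  rw [← div_div, lt_div_iff₀ (by positivity)]
  calc _ = D * ((D + 1 : ℝ) * (u - rootStep (D + 1))) := by ring
    _ = D * (2 * u - l) := by rw [hv]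
    _ < _ := h1

lemma exists_mixedWeight_le {D : ℕ} (hD : 1 ≤ D) :
    ∃ θ : ℝ, θ < 1 ∧ ∀ N < D, mixedWeight D N ≤ θ := by
  have h0 : (0 : ℝ) < D := by exact_mod_cast hD
  have hk := rootStep_drop_lt hD
  -- With `M = D - N` the weight is at most `exp (M κ)` for a fixed `κ < 0`; the worst case `M = 1`
  -- gives the witness.
  refine ⟨Real.exp (rootStep D - rootStep (D + 1) - (1 - Real.exp (-rootStep D)) / D), ?_, ?_⟩
  · rw [Real.exp_lt_one_iff]; linarith
  intro N hN
  have hM : (1 : ℝ) ≤ ((D - N : ℕ) : ℝ) := by exact_mod_cast (by omega : 1 ≤ D - N)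
  have hNM : (N : ℝ) = D - ((D - N : ℕ) : ℝ) := by
    rw [Nat.cast_sub hN.le]; ring
  set M : ℝ := ((D - N : ℕ) : ℝ) with hMdef
  set u := rootStep D with hudef
  set v := u - rootStep (D + 1) with hv
  have hlg : Real.exp (-logRoot D) = Real.exp (-logRoot (D - 1)) * Real.exp (-u) := by
    rw [← Real.exp_add]; congr 1; rw [hudef, rootStep]; ring
  have hself := exp_neg_mul_rootStep hD
  have hF : mixedWeight D N = Real.exp (M * v) * (1 - M / D * (1 - Real.exp (-u))) := by
    have e1 : mixedWeight D N = Real.exp (M * v) *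
        Real.exp (-(D * u) - logRoot (D - 1)) * (N + M * Real.exp (-u)) := by
      rw [← Real.exp_add, mixedWeight, hlg, ← hMdef]
      have : Real.exp (M * v + (-(D * u) - logRoot (D - 1))) =
          Real.exp (-(N * u) - M * rootStep (D + 1)) * Real.exp (-logRoot (D - 1)) := by
        rw [← Real.exp_add]; congr 1; rw [hNM, hv]; ring
      rw [this]; ring
    rw [e1, hself, hNM]; field_simp; ring
  rw [hF]
  calc Real.exp (M * v) * (1 - M / D * (1 - Real.exp (-u)))
      ≤ Real.exp (M * v) * Real.exp (-(M / D * (1 - Real.exp (-u)))) := by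
        apply mul_le_mul_of_nonneg_left _ (Real.exp_pos _).le
        linarith [Real.add_one_le_exp (-(M / D * (1 - Real.exp (-u))))]
    _ = Real.exp (M * (v - (1 - Real.exp (-u)) / D)) := by
        rw [← Real.exp_add]; congr 1; ring
    _ ≤ _ := by
        apply Real.exp_le_exp.2
        nlinarith

/-! ### Partial permanents and Bregman's inequality -/

section Matchings

variable {α : Type*} [Fintype α] [DecidableEq α] (a : α → α → Prop) [DecidableRel a]

/-- The injections of `R` into `S` along the relation `a`, extended by the identity off `R`. -/
def matchings (R S : Finset α) : Finset (α → α) :=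
  Finset.univ.filter fun f =>
    (∀ i, i ∉ R → f i = i) ∧ (∀ i ∈ R, f i ∈ S ∧ a i (f i)) ∧ Set.InjOn f R

/-- The number of injections of `R` into `S` along `a`: the permanent of the submatrix on the rows
`R` and the columns `S` if these have the same size. -/
def subPer (R S : Finset α) : ℕ := (matchings a R S).card

/-- The number of ones of row `i` in the columns `S`. -/
def rowSum (S : Finset α) (i : α) : ℕ := (S.filter (a i)).card

/-- The logarithm of the product of `(r!)^(1/r)` over the row sums `r` of the submatrix on `R` and
`S`. -/
noncomputable def logBound (R S : Finset α) : ℝ := ∑ i ∈ R, logRoot (rowSum a S i)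

variable {a}

lemma mem_matchings {R S : Finset α} {f : α → α} : f ∈ matchings a R S ↔
    (∀ i, i ∉ R → f i = i) ∧ (∀ i ∈ R, f i ∈ S ∧ a i (f i)) ∧ Set.InjOn f R := by
  simp [matchings]

lemma card_matchings_filter_eq {R S : Finset α} {i k : α} (hi : i ∈ R) (hk : k ∈ S)
    (hik : a i k) :
    ((matchings a R S).filter fun f => f i = k).card = subPer a (R.erase i) (S.erase k) := by
  unfold subPer
  refine Finset.card_nbij' (fun f => Function.update f i i) (fun f => Function.update f i k)
    ?_ ?_ ?_ ?_
  · intro f hf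
    simp only [Finset.coe_filter, Set.mem_ofPred_eq, mem_matchings] at hf
    obtain ⟨⟨h1, h2, h3⟩, h4⟩ := hf
    simp only [Finset.mem_coe, mem_matchings]
    refine ⟨fun j hj => ?_, fun j hj => ?_, ?_⟩
    · by_cases h : j = i
      · subst h; simp
      · rw [Function.update_of_ne h]; exact h1 j fun hR => hj (Finset.mem_erase.2 ⟨h, hR⟩)
    · obtain ⟨hji, hjR⟩ := Finset.mem_erase.1 hj
      rw [Function.update_of_ne hji]
      refine ⟨Finset.mem_erase.2 ⟨fun h => hji ?_, (h2 j hjR).1⟩, (h2 j hjR).2⟩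
      exact h3 hjR hi (h.trans h4.symm)
    · intro j hj j' hj' h
      obtain ⟨hji, hjR⟩ := Finset.mem_erase.1 hj
      obtain ⟨hji', hjR'⟩ := Finset.mem_erase.1 hj'
      simp only [Function.update_of_ne hji, Function.update_of_ne hji'] at h
      exact h3 hjR hjR' h
  · intro f hf
    simp only [Finset.mem_coe, mem_matchings] at hf
    obtain ⟨h1, h2, h3⟩ := hf
    simp only [Finset.coe_filter, Set.mem_ofPred_eq, mem_matchings, Function.update_self, and_true]
    refine ⟨fun j hj => ?_, fun j hj => ?_, ?_⟩
    · have h : j ≠ i := fun h => hj (h ▸ hi)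
      rw [Function.update_of_ne h]; exact h1 j fun hR => hj (Finset.mem_of_mem_erase hR)
    · by_cases h : j = i
      · subst h; simp [hk, hik]
      · rw [Function.update_of_ne h]
        have := h2 j (Finset.mem_erase.2 ⟨h, hj⟩)
        exact ⟨Finset.mem_of_mem_erase this.1, this.2⟩
    · intro j hj j' hj' h
      have aux : ∀ j ∈ R, j ≠ i → f j ≠ k := fun j hj hji =>
        (Finset.mem_erase.1 (h2 j (Finset.mem_erase.2 ⟨hji, hj⟩)).1).1
      by_cases hji : j = i <;> by_cases hji' : j' = i
      · rw [hji, hji']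
      · subst hji
        simp only [Function.update_self, Function.update_of_ne hji'] at h
        exact absurd h.symm (aux j' hj' hji')
      · subst hji'
        simp only [Function.update_self, Function.update_of_ne hji] at h
        exact absurd h (aux j hj hji)
      · simp only [Function.update_of_ne hji, Function.update_of_ne hji'] at h
        exact h3 (Finset.mem_coe.2 (Finset.mem_erase.2 ⟨hji, hj⟩))
          (Finset.mem_coe.2 (Finset.mem_erase.2 ⟨hji', hj'⟩)) h
  · intro f hf
    simp only [Finset.coe_filter, Set.mem_ofPred_eq] at hf
    simp [← hf.2]
  · intro f hf
    simp only [Finset.mem_coe, mem_matchings] at hf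
    have : f i = i := hf.1 i (by simp)
    funext j
    by_cases h : j = i
    · subst h; simp [this]
    · simp [h]

/-- Expansion along a row. -/
lemma subPer_row {R S : Finset α} {i : α} (hi : i ∈ R) :
    subPer a R S = ∑ k ∈ S.filter (a i), subPer a (R.erase i) (S.erase k) := by
  have : ∀ f ∈ matchings a R S, f i ∈ S.filter (a i) := fun f hf =>
    Finset.mem_filter.2 ((mem_matchings.1 hf).2.1 i hi)
  rw [subPer, Finset.card_eq_sum_card_fiberwise this]
  refine Finset.sum_congr rfl fun k hk => ?_
  obtain ⟨hk, hik⟩ := Finset.mem_filter.1 hk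
  exact card_matchings_filter_eq hi hk hik

/-- Expansion along a column. -/
lemma subPer_col {R S : Finset α} (hRS : R.card = S.card) {k : α} (hk : k ∈ S) :
    subPer a R S = ∑ i ∈ R.filter (a · k), subPer a (R.erase i) (S.erase k) := by
  have h1 : matchings a R S =
      (R.filter (a · k)).biUnion fun i => (matchings a R S).filter fun f => f i = k := by
    ext f
    simp only [Finset.mem_biUnion, Finset.mem_filter]
    refine ⟨fun hf => ?_, fun ⟨i, _, h, _⟩ => h⟩
    obtain ⟨h1, h2, h3⟩ := mem_matchings.1 hf
    -- Equal cardinalities make every matching hit column `k`; this is the only use of `hRS`.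
    have him : R.image f = S := by
      apply Finset.eq_of_subset_of_card_le
      · intro y hy
        obtain ⟨i, hi, rfl⟩ := Finset.mem_image.1 hy
        exact (h2 i hi).1
      · rw [Finset.card_image_of_injOn h3, hRS]
    rw [← him] at hk
    obtain ⟨i, hi, rfl⟩ := Finset.mem_image.1 hk
    exact ⟨i, ⟨hi, (h2 i hi).2⟩, hf, rfl⟩
  rw [subPer]
  conv_lhs => rw [h1]
  rw [Finset.card_biUnion]
  · refine Finset.sum_congr rfl fun i hi => ?_
    obtain ⟨hi, hik⟩ := Finset.mem_filter.1 hi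
    exact card_matchings_filter_eq hi hk hik
  · intro i hi j hj hij
    rw [Function.onFun, Finset.disjoint_left]
    intro f hf hf'
    obtain ⟨hf, h⟩ := Finset.mem_filter.1 hf
    obtain ⟨-, h'⟩ := Finset.mem_filter.1 hf'
    exact hij ((mem_matchings.1 hf).2.2 (Finset.mem_filter.1 hi).1 (Finset.mem_filter.1 hj).1
      (h.trans h'.symm))

lemma rowSum_erase_of_rel {S : Finset α} {j k : α} (hk : k ∈ S) (h : a j k) :
    rowSum a (S.erase k) j = rowSum a S j - 1 := by
  unfold rowSum
  rw [Finset.filter_erase, Finset.card_erase_of_mem (Finset.mem_filter.2 ⟨hk, h⟩)]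

lemma rowSum_erase_of_not_rel {S : Finset α} {j k : α} (h : ¬ a j k) :
    rowSum a (S.erase k) j = rowSum a S j := by
  unfold rowSum
  rw [Finset.filter_erase, Finset.erase_eq_of_notMem]
  simp [h]

lemma logRoot_rowSum_erase {S : Finset α} {j k : α} (hk : k ∈ S) :
    logRoot (rowSum a (S.erase k) j) =
      logRoot (rowSum a S j) - if a j k then rootStep (rowSum a S j) else 0 := by
  split_ifs with h
  · rw [rowSum_erase_of_rel hk h, rootStep]; ring
  · rw [rowSum_erase_of_not_rel h]; ring

/-- The effect on `logBound` of deleting a row and a column that meet in a one. -/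
lemma logBound_erase {R S : Finset α} {i k : α} (hi : i ∈ R) (hk : k ∈ S) (hik : a i k) :
    logBound a (R.erase i) (S.erase k) = logBound a R S -
      (∑ j ∈ R.filter (a · k), rootStep (rowSum a S j)) - logRoot (rowSum a S i - 1) := by
  have h1 : ∑ j ∈ R, logRoot (rowSum a (S.erase k) j) =
      logBound a R S - ∑ j ∈ R.filter (a · k), rootStep (rowSum a S j) := by
    rw [Finset.sum_congr rfl fun j _ => logRoot_rowSum_erase (j := j) hk, Finset.sum_sub_distrib,
      Finset.sum_filter, logBound]
  have h2 := Finset.add_sum_erase R (fun j => logRoot (rowSum a (S.erase k) j)) hi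
  rw [rowSum_erase_of_rel hk hik] at h2
  rw [logBound]; linarith

/-- Jensen's inequality for the entropy of a finite distribution with unnormalised weights. -/
lemma sum_mul_log_ge {ι : Type*} (s : Finset ι) (w : ι → ℝ) (hw : ∀ i ∈ s, 0 ≤ w i)
    (hpos : 0 < ∑ i ∈ s, w i) :
    (∑ i ∈ s, w i) * Real.log (∑ i ∈ s, w i) ≤
      (∑ i ∈ s, w i) * Real.log s.card + ∑ i ∈ s, w i * Real.log (w i) := by
  have hc : 0 < s.card := by
    rw [Finset.card_pos, Finset.nonempty_iff_ne_empty]; rintro rfl; simp at hpos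
  have hc' : (0 : ℝ) < s.card := by exact_mod_cast hc
  set T := ∑ i ∈ s, w i with hT
  have key : ∀ i ∈ s, w i * (Real.log T - Real.log s.card) ≤
      w i * Real.log (w i) + (T / s.card - w i) := by
    intro i hi
    rcases (hw i hi).eq_or_lt with h | h
    · rw [← h]; simp; positivity
    · have h1 : Real.log (T / (s.card * w i)) ≤ T / (s.card * w i) - 1 :=
        Real.log_le_sub_one_of_pos (by positivity)
      rw [Real.log_div hpos.ne' (by positivity), Real.log_mul hc'.ne' h.ne'] at h1
      have h2 := mul_le_mul_of_nonneg_left h1 h.le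
      have h3 : w i * (T / (s.card * w i) - 1) = T / s.card - w i := by field_simp
      rw [h3] at h2
      linarith
  have := Finset.sum_le_sum key
  rw [← Finset.sum_mul, Finset.sum_add_distrib, Finset.sum_sub_distrib, Finset.sum_const,
    nsmul_eq_mul, ← hT] at this
  have h3 : (s.card : ℝ) * (T / s.card) = T := by field_simp
  linarith

lemma subPer_empty (S : Finset α) : subPer a ∅ S = 1 := by
  rw [subPer, Finset.card_eq_one]
  refine ⟨id, ?_⟩
  ext f
  simp [mem_matchings, funext_iff]

/-- Bregman's inequality: the permanent is at most the product of `(r!)^(1/r)` over the row sums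
`r`. -/
theorem subPer_le_exp_logBound (R S : Finset α) (hRS : R.card = S.card) :
    (subPer a R S : ℝ) ≤ Real.exp (logBound a R S) := by
  induction hn : R.card generalizing R S with
  | zero =>
    rw [Finset.card_eq_zero] at hn
    subst hn
    simp [subPer_empty, logBound]
  | succ n ih =>
    rcases Nat.eq_zero_or_pos (subPer a R S) with h0 | hpos
    · rw [h0]; simpa using (Real.exp_pos _).le
    have hP : (0 : ℝ) < subPer a R S := by exact_mod_cast hpos
    set P : ℝ := ((subPer a R S : ℕ) : ℝ) with hPdef
    -- Schrijver's argument: the minors `w i k` have all row and column sums equal to `P`, so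
    -- expanding along every row at once turns the averages over minors into averages over rows.
    set w : α → α → ℝ := fun i k =>
      if a i k then (subPer a (R.erase i) (S.erase k) : ℝ) else 0 with hwdef
    have hw0 : ∀ i k, 0 ≤ w i k := fun i k => by simp only [hwdef]; split_ifs <;> positivity
    have hrow : ∀ i ∈ R, ∑ k ∈ S, w i k = P := fun i hi => by
      rw [hPdef, subPer_row hi, Nat.cast_sum, Finset.sum_filter]
    have hcol : ∀ k ∈ S, ∑ i ∈ R, w i k = P := fun k hk => by
      rw [hPdef, subPer_col hRS hk, Nat.cast_sum, Finset.sum_filter]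
    set r := rowSum a S with hr
    set L := logBound a R S with hL
    have hr1 : ∀ i ∈ R, 1 ≤ r i := fun i hi => by
      by_contra h
      have : S.filter (a i) = ∅ := Finset.card_eq_zero.1 (by simp only [hr, rowSum] at h; omega)
      rw [subPer_row hi, this] at hpos
      simp at hpos
    have hstep : ∀ i ∈ R, P * Real.log P ≤ P * Real.log (r i) +
        ∑ k ∈ S, w i k * (L - logRoot (r i - 1) -
          ∑ j ∈ R, if a j k then rootStep (r j) else 0) := by
      intro i hi
      have hj := sum_mul_log_ge (S.filter (a i)) (w i) (fun k _ => hw0 i k) (by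
        have := hrow i hi
        rw [Finset.sum_filter_of_ne] <;> [rw [this]; skip]
        · exact hP
        · intro k _ h; by_contra hc; exact h (by simp [hwdef, hc]))
      have hs : ∑ k ∈ S.filter (a i), w i k = P := by
        rw [Finset.sum_filter_of_ne, hrow i hi]
        intro k _ h; by_contra hc; exact h (by simp [hwdef, hc])
      rw [hs] at hj
      refine hj.trans (add_le_add le_rfl ?_)
      rw [Finset.sum_filter]
      refine Finset.sum_le_sum fun k hk => ?_
      split_ifs with hik
      · rcases (hw0 i k).eq_or_lt with h | h
        · rw [← h]; simp
        · apply mul_le_mul_of_nonneg_left _ h.le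
          have hih := ih (R.erase i) (S.erase k)
            (by rw [Finset.card_erase_of_mem hi, Finset.card_erase_of_mem hk, hRS])
            (by rw [Finset.card_erase_of_mem hi, hn]; rfl)
          have hw : w i k = subPer a (R.erase i) (S.erase k) := by simp [hwdef, hik]
          rw [← hw] at hih
          have := (Real.log_le_iff_le_exp h).2 hih
          rw [logBound_erase hi hk hik, Finset.sum_filter] at this
          linarith
      · simp [hwdef, hik]
    have hsum := Finset.sum_le_sum hstep
    have e1 : ∑ i ∈ R, ∑ k ∈ S, w i k * (L - logRoot (r i - 1) -
          ∑ j ∈ R, if a j k then rootStep (r j) else 0) =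
        P * ∑ i ∈ R, (L - logRoot (r i - 1)) - P * ∑ j ∈ R, r j * rootStep (r j) := by
      have e2 : ∑ i ∈ R, ∑ k ∈ S, w i k * ∑ j ∈ R, (if a j k then rootStep (r j) else 0) =
          P * ∑ j ∈ R, r j * rootStep (r j) := by
        rw [Finset.sum_comm]
        simp only [← Finset.sum_mul]
        rw [Finset.sum_congr rfl fun k hk => by rw [hcol k hk], ← Finset.mul_sum,
          Finset.sum_comm]
        congr 1
        refine Finset.sum_congr rfl fun j _ => ?_
        rw [← Finset.sum_filter, Finset.sum_const, nsmul_eq_mul]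
        rfl
      rw [← e2, Finset.mul_sum, ← Finset.sum_sub_distrib]
      refine Finset.sum_congr rfl fun i hi => ?_
      rw [← hrow i hi, Finset.sum_mul, ← Finset.sum_sub_distrib]
      exact Finset.sum_congr rfl fun k _ => mul_sub _ _ _
    rw [Finset.sum_add_distrib, e1, Finset.sum_const, nsmul_eq_mul, ← Finset.mul_sum] at hsum
    -- By `mul_rootStep` the terms of each row cancel to `L`, so the induction hypothesis returns
    -- exactly Bregman's bound.
    have e3 : ∑ i ∈ R, Real.log (r i) + (∑ i ∈ R, (L - logRoot (r i - 1)) -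
        ∑ j ∈ R, r j * rootStep (r j)) = R.card * L := by
      rw [← Finset.sum_sub_distrib, ← Finset.sum_add_distrib,
        Finset.sum_congr rfl (g := fun _ => L), Finset.sum_const, nsmul_eq_mul]
      intro i hi
      have := mul_rootStep (hr1 i hi)
      linarith
    have hc : (0 : ℝ) < R.card := by rw [hn]; positivity
    have h4 : (R.card * P) * Real.log P ≤ (R.card * P) * L := by
      calc _ = R.card * (P * Real.log P) := by ring
        _ ≤ _ := hsum
        _ = P * (∑ i ∈ R, Real.log (r i) + (∑ i ∈ R, (L - logRoot (r i - 1)) -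
              ∑ j ∈ R, r j * rootStep (r j))) := by ring
        _ = _ := by rw [e3]; ring
    exact (Real.log_le_iff_le_exp hP).1 (le_of_mul_le_mul_left h4 (by positivity))

end Matchings
-- Local improvements of Bregman's bound
section Gain

variable {α : Type*} [Fintype α] [DecidableEq α] (a : α → α → Prop) [DecidableRel a]

/-- The number of ones in column `k`. -/
def colSum (k : α) : ℕ := (Finset.univ.filter (a · k)).card

/-- The rows that meet row `i` belong to `R`, and all their ones lie in the columns `S`. -/
def IntactAt (i : α) (R S : Finset α) : Prop :=
  ∀ k j, a i k → a j k → j ∈ R ∧ ∀ l, a j l → l ∈ S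

/-- The rows that meet row `i` have no column in common with the rows that meet row `i'`. -/
def FarApart (i i' : α) : Prop :=
  ∀ j j' k k' l, a i k → a j k → a i' k' → a j' k' → a j l → ¬ a j' l

/-- Expanding along row `i` improves Bregman's bound by the factor `θ`. -/
def LightRow (d : ℕ) (θ : ℝ) (i : α) : Prop :=
  ∑ k ∈ Finset.univ.filter (a i), colWeight d (colSum a k) ≤ θ

/-- The columns through row `i` have sum `d`, but not all ones of two of them are in common
rows. -/
def SkewRow (d : ℕ) (i : α) : Prop :=
  (∀ k, a i k → colSum a k = d) ∧
    ∃ k l, a i k ∧ a i l ∧ k ≠ l ∧ (Finset.univ.filter fun j => a j k ∧ a j l).card < d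

variable {a}

/-- The deleted row and column both lie near row `i`, and `FarApart` keeps them away from everything
that `IntactAt` protects around `i'`. -/
lemma IntactAt.erase {i i' : α} {R S : Finset α} (h : IntactAt a i' R S) (hsep : FarApart a i i')
    {j k l : α} (hk : a i k) (hj : a j k) (hl : a i l) :
    IntactAt a i' (R.erase j) (S.erase l) := by
  intro k' j' hk' hj'
  obtain ⟨h1, h2⟩ := h k' j' hk' hj'
  refine ⟨Finset.mem_erase.2 ⟨?_, h1⟩, fun l' hl' => Finset.mem_erase.2 ⟨?_, h2 l' hl'⟩⟩
  · rintro rfl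
    exact hsep _ _ _ _ k' hk hj hk' hj' hj' hj'
  · rintro rfl
    exact hsep i j' l' k' l' hl hl hk' hj' hl hl'

lemma IntactAt.filter_eq {i : α} {R S : Finset α} (h : IntactAt a i R S) {k : α} (hk : a i k) :
    R.filter (a · k) = Finset.univ.filter (a · k) := by
  ext j
  simp only [Finset.mem_filter, Finset.mem_univ, true_and, and_iff_right_iff_imp]
  exact fun hj => (h k j hk hj).1

lemma IntactAt.rowSum_eq {i : α} {R S : Finset α} (h : IntactAt a i R S) {j k : α} (hk : a i k)
    (hj : a j k) : rowSum a S j = rowSum a Finset.univ j := by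
  unfold rowSum
  congr 1
  ext l
  simp only [Finset.mem_filter, Finset.mem_univ, true_and, and_iff_right_iff_imp]
  exact (h k j hk hj).2 l

variable {d : ℕ}

lemma exp_logBound_erase (hrow : ∀ i, rowSum a Finset.univ i = d) {i : α} {R S : Finset α}
    (h : IntactAt a i R S) {k : α} (hk : a i k) :
    Real.exp (logBound a (R.erase i) (S.erase k)) =
      Real.exp (logBound a R S) * colWeight d (colSum a k) := by
  obtain ⟨hi, hS⟩ := h k i hk hk
  rw [logBound_erase hi (hS k hk) hk, colWeight, ← Real.exp_add, h.rowSum_eq hk hk, hrow,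
    h.filter_eq hk, Finset.sum_congr rfl (g := fun _ => rootStep d), Finset.sum_const,
    nsmul_eq_mul, colSum]
  · congr 1; ring
  · intro j hj
    rw [h.rowSum_eq hk (Finset.mem_filter.1 hj).2, hrow]

lemma subPer_le_of_row_weights {i : α} {R S : Finset α} (hi : i ∈ R)
    (h : IntactAt a i R S) {b : ℝ} {W : α → ℝ}
    (hW : ∀ k, a i k → (subPer a (R.erase i) (S.erase k) : ℝ) ≤ b * W k) :
    (subPer a R S : ℝ) ≤ b * ∑ k ∈ Finset.univ.filter (a i), W k := by
  have hS : S.filter (a i) = Finset.univ.filter (a i) := by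
    ext k
    simp only [Finset.mem_filter, Finset.mem_univ, true_and, and_iff_right_iff_imp]
    exact fun hk => (h k i hk hk).2 k hk
  rw [subPer_row hi, hS, Nat.cast_sum, Finset.mul_sum]
  exact Finset.sum_le_sum fun k hk => hW k (Finset.mem_filter.1 hk).2

/-- Deleting row `i` and column `k` and then expanding along column `l` gives a factor
`mixedWeight`. -/
lemma subPer_erase_le_mixedWeight (hd : 2 ≤ d) (hrow : ∀ i, rowSum a Finset.univ i = d) {i : α}
    {R S : Finset α} (hRS : R.card = S.card) (h : IntactAt a i R S) {k l : α} (hk : a i k)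
    (hl : a i l) (hkl : k ≠ l) (hcl : colSum a l = d) {t : ℝ}
    (ht : ∀ j, j ≠ i → a j l → (subPer a ((R.erase i).erase j) ((S.erase k).erase l) : ℝ) ≤
      t * Real.exp (logBound a ((R.erase i).erase j) ((S.erase k).erase l))) :
    (subPer a (R.erase i) (S.erase k) : ℝ) ≤ t * (Real.exp (logBound a (R.erase i) (S.erase k)) *
      mixedWeight (d - 1) ((Finset.univ.filter fun j => a j k ∧ a j l).card - 1)) := by
  obtain ⟨hi, hS⟩ := h k i hk hk
  set R' := R.erase i with hR'
  set S' := S.erase k with hS'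
  set N := (Finset.univ.filter fun j => a j k ∧ a j l).card - 1 with hN
  set L := logBound a R' S' with hL
  have hlS' : l ∈ S' := Finset.mem_erase.2 ⟨hkl.symm, hS l hl⟩
  have hcard : R'.card = S'.card := by
    rw [hR', hS', Finset.card_erase_of_mem hi, Finset.card_erase_of_mem (hS k hk), hRS]
  set X := R'.filter (a · l) with hX
  have hXe : X = (Finset.univ.filter (a · l)).erase i := by
    rw [hX, hR', Finset.filter_erase, h.filter_eq hl]
  -- Column `l` loses row `i`. Of its remaining `d - 1` ones, the `N` in rows that also meet `k` now
  -- have row sum `d - 1`, the others still `d`.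
  have hXc : X.card = d - 1 := by
    rw [hXe, Finset.card_erase_of_mem (by simp [hl])]
    rw [colSum] at hcl; rw [hcl]
  have hXN : (X.filter (a · k)).card = N := by
    have : X.filter (a · k) = (Finset.univ.filter fun j => a j k ∧ a j l).erase i := by
      rw [hXe]; ext j; simp; tauto
    rw [this, Finset.card_erase_of_mem (by simp [hl, hk])]
  have hXN' : (X.filter (¬ a · k)).card = d - 1 - N := by
    have := Finset.card_filter_add_card_filter_not (s := X) (a · k)
    omega
  have hr : ∀ j ∈ X, rowSum a S' j = if a j k then d - 1 else d := by
    intro j hj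
    have hjl : a j l := (Finset.mem_filter.1 hj).2
    split_ifs with hjk
    · rw [hS', rowSum_erase_of_rel (hS k hk) hjk, h.rowSum_eq hk hjk, hrow]
    · rw [hS', rowSum_erase_of_not_rel hjk, h.rowSum_eq hl hjl, hrow]
  have hsplit : ∀ F : ℕ → ℝ, ∑ j ∈ X, F (rowSum a S' j) =
      N * F (d - 1) + ((d - 1 - N : ℕ) : ℝ) * F d := by
    intro F
    rw [← Finset.sum_filter_add_sum_filter_not X (a · k), ← hXN', ← hXN]
    congr 1
    · rw [Finset.sum_congr rfl (g := fun _ => F (d - 1)), Finset.sum_const, nsmul_eq_mul]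
      intro j hj
      obtain ⟨hj, hjk⟩ := Finset.mem_filter.1 hj
      rw [hr j hj, if_pos hjk]
    · rw [Finset.sum_congr rfl (g := fun _ => F d), Finset.sum_const, nsmul_eq_mul]
      intro j hj
      obtain ⟨hj, hjk⟩ := Finset.mem_filter.1 hj
      rw [hr j hj, if_neg hjk]
  rw [subPer_col hcard hlS', Nat.cast_sum]
  have hle : ∀ j ∈ X, (subPer a (R'.erase j) (S'.erase l) : ℝ) ≤
      t * (Real.exp L * Real.exp (-∑ j ∈ X, rootStep (rowSum a S' j)) *
        Real.exp (-logRoot (rowSum a S' j - 1))) := by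
    intro j hj
    obtain ⟨hjR, hjl⟩ := Finset.mem_filter.1 hj
    refine (ht j (Finset.mem_erase.1 hjR).1 hjl).trans (le_of_eq ?_)
    rw [logBound_erase hjR hlS' hjl, ← Real.exp_add, ← Real.exp_add]
    congr 2
  refine (Finset.sum_le_sum hle).trans (le_of_eq ?_)
  rw [← Finset.mul_sum, ← Finset.mul_sum, hsplit, hsplit fun r => Real.exp (-logRoot (r - 1)),
    mixedWeight, show d - 1 + 1 = d by omega, mul_assoc, neg_add, ← sub_eq_add_neg]

/-- Bregman's bound improves by a fixed factor for each member of a family of light or skew rows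
that are pairwise far apart. -/
theorem subPer_le_pow_mul (hd : 2 ≤ d) (hrow : ∀ i, rowSum a Finset.univ i = d) {θ θ' : ℝ}
    (hθ : 0 ≤ θ) (hθ' : ∀ N < d - 1, mixedWeight (d - 1) N ≤ θ') (hθθ' : (d - 1 + θ') / d ≤ θ)
    (T : Finset α) : (∀ i ∈ T, LightRow a d θ i ∨ SkewRow a d i) →
    (∀ i ∈ T, ∀ j ∈ T, i ≠ j → FarApart a i j) →
    ∀ R S : Finset α, R.card = S.card → (∀ i ∈ T, IntactAt a i R S) →
    (subPer a R S : ℝ) ≤ θ ^ T.card * Real.exp (logBound a R S) := by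
  have hd0 : (0 : ℝ) < d := by positivity
  induction T using Finset.induction_on with
  | empty => intro _ _ R S hRS _; simpa using subPer_le_exp_logBound R S hRS
  | insert i T hiT ih =>
    intro hgood hfar R S hRS hint
    have ih' := ih (fun j hj => hgood j (Finset.mem_insert_of_mem hj))
      (fun j hj j' hj' => hfar j (Finset.mem_insert_of_mem hj) j' (Finset.mem_insert_of_mem hj'))
    have hI := hint i (Finset.mem_insert_self _ _)
    have hsep : ∀ j ∈ T, FarApart a i j := fun j hj =>
      hfar i (Finset.mem_insert_self _ _) j (Finset.mem_insert_of_mem hj) fun h => hiT (h ▸ hj)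
    have hne : (Finset.univ.filter (a i)).Nonempty := by
      rw [← Finset.card_pos]; have := hrow i; rw [rowSum] at this; omega
    obtain ⟨k₁, hk₁⟩ := hne
    have hi : i ∈ R := (hI k₁ i (Finset.mem_filter.1 hk₁).2 (Finset.mem_filter.1 hk₁).2).1
    have hT0 : 0 ≤ θ ^ T.card := pow_nonneg hθ _
    have hcard : ∀ k, a i k → (R.erase i).card = (S.erase k).card := fun k hk => by
      rw [Finset.card_erase_of_mem hi, Finset.card_erase_of_mem ((hI k i hk hk).2 k hk), hRS]
    have hint' : ∀ k, a i k → ∀ j ∈ T, IntactAt a j (R.erase i) (S.erase k) := fun k hk j hj =>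
      (hint j (Finset.mem_insert_of_mem hj)).erase (hsep j hj) hk hk hk
    have hbase : ∀ k, a i k → (subPer a (R.erase i) (S.erase k) : ℝ) ≤
        (θ ^ T.card * Real.exp (logBound a R S)) * colWeight d (colSum a k) := fun k hk => by
      have := ih' (R.erase i) (S.erase k) (hcard k hk) (hint' k hk)
      rwa [exp_logBound_erase hrow hI hk, ← mul_assoc] at this
    have hgoal : ∀ s : ℝ, s ≤ θ → (subPer a R S : ℝ) ≤
        (θ ^ T.card * Real.exp (logBound a R S)) * s →
        (subPer a R S : ℝ) ≤ θ ^ (insert i T).card * Real.exp (logBound a R S) := by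
      intro s hs h
      refine h.trans ?_
      rw [Finset.card_insert_of_notMem hiT, pow_succ]
      calc _ ≤ (θ ^ T.card * Real.exp (logBound a R S)) * θ :=
            mul_le_mul_of_nonneg_left hs (mul_nonneg hT0 (Real.exp_pos _).le)
        _ = _ := by ring
    rcases hgood i (Finset.mem_insert_self _ _) with hlight | ⟨hreg, k, l, hk, hl, hkl, hN⟩
    · exact hgoal _ hlight (subPer_le_of_row_weights hi hI hbase)
    -- Only the minor at `k` is expanded a second time, along `l`; the other `d - 1` minors keep the
    -- weight `1/d`. The total is `(d - 1 + θ') / d`.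
    · have hkw : (subPer a (R.erase i) (S.erase k) : ℝ) ≤
          (θ ^ T.card * Real.exp (logBound a R S)) * (1 / d * θ') := by
        have h1 := subPer_erase_le_mixedWeight hd hrow hRS hI hk hl hkl (hreg l hl)
          (t := θ ^ T.card) (fun j hji hjl => by
            have hj : j ∈ R.erase i := Finset.mem_erase.2 ⟨hji, (hI l j hl hjl).1⟩
            have hlS : l ∈ S.erase k := Finset.mem_erase.2 ⟨hkl.symm, (hI k i hk hk).2 l hl⟩
            refine ih' _ _ ?_ fun j' hj' => (hint' k hk j' hj').erase (hsep j' hj') hl hjl hl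
            rw [Finset.card_erase_of_mem hj, Finset.card_erase_of_mem hlS, hcard k hk])
        refine h1.trans ?_
        rw [exp_logBound_erase hrow hI hk, hreg k hk, colWeight_self (by omega), mul_assoc,
          mul_assoc]
        have hpos : 0 < (Finset.univ.filter fun j => a j k ∧ a j l).card :=
          Finset.card_pos.2 ⟨i, by simp [hk, hl]⟩
        gcongr
        exact hθ' _ (by omega)
      refine hgoal ((d - 1 + θ') / d) hθθ' ?_
      have h2 := subPer_le_of_row_weights hi hI (b := θ ^ T.card * Real.exp (logBound a R S))
        (W := fun k' => if k' = k then 1 / d * θ' else 1 / d) (fun k' hk' => by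
          by_cases h : k' = k
          · subst h; simpa using hkw
          · have := hbase k' hk'
            rw [hreg k' hk', colWeight_self (by omega)] at this
            simpa [h] using this)
      refine h2.trans (le_of_eq ?_)
      congr 1
      have hkm : k ∈ Finset.univ.filter (a i) := by simp [hk]
      rw [← Finset.add_sum_erase _ _ hkm, if_pos rfl,
        Finset.sum_congr rfl (g := fun _ => (1 / d : ℝ)), Finset.sum_const,
        Finset.card_erase_of_mem hkm, nsmul_eq_mul]
      · have hrd : (Finset.univ.filter (a i)).card = d := hrow i
        rw [hrd, Nat.cast_sub (by omega)]
        push_cast; ring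
      · intro k' hk'
        rw [if_neg (Finset.mem_erase.1 hk').1]

end Gain
-- Windows of columns in matrices with contiguous rows
/-- Row `i` has its ones in the columns `x i, …, x i + d - 1`. -/
def blockRel (d : ℕ) {n : ℕ} (x : Fin n → ℕ) (i k : Fin n) : Prop :=
  x i ≤ (k : ℕ) ∧ (k : ℕ) < x i + d

instance (d : ℕ) {n : ℕ} (x : Fin n → ℕ) : DecidableRel (blockRel d x) := fun i k =>
  inferInstanceAs (Decidable (x i ≤ (k : ℕ) ∧ (k : ℕ) < x i + d))

lemma card_fin_between_le {n : ℕ} (p q : ℕ) :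
    (Finset.univ.filter fun k : Fin n => p ≤ (k : ℕ) ∧ (k : ℕ) < q).card ≤ q - p := by
  rw [← Nat.card_Ico, ← Finset.card_map Fin.valEmbedding]
  apply Finset.card_le_card
  intro k hk
  simp only [Finset.mem_map, Finset.mem_filter, Finset.mem_univ, true_and] at hk
  obtain ⟨k, hk, rfl⟩ := hk
  simpa using hk

lemma card_fin_between {n : ℕ} {p q : ℕ} (hq : q ≤ n) :
    (Finset.univ.filter fun k : Fin n => p ≤ (k : ℕ) ∧ (k : ℕ) < q).card = q - p := by
  rw [← Nat.card_Ico, ← Finset.card_map Fin.valEmbedding]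
  congr 1
  ext k
  simp only [Finset.mem_map, Finset.mem_filter, Finset.mem_univ, true_and, Finset.mem_Ico]
  constructor
  · rintro ⟨k, hk, rfl⟩; simpa using hk
  · intro hk; exact ⟨⟨k, by omega⟩, hk, rfl⟩

lemma rowSum_blockRel {d n : ℕ} {x : Fin n → ℕ} {i : Fin n} (hx : x i + d ≤ n) :
    rowSum (blockRel d x) Finset.univ i = d := by
  have := card_fin_between (n := n) (p := x i) hx
  exact this.trans (Nat.add_sub_cancel_left _ _)

lemma rootStep_le_inv {d : ℕ} (hd : 1 ≤ d) : rootStep d ≤ 1 / d := by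
  have h0 : (0 : ℝ) < d := by exact_mod_cast hd
  rw [le_div_iff₀ h0, mul_comm]
  exact (mul_le_mul_of_nonneg_left (rootStep_bounds hd).2 h0.le).trans
    (mul_log_one_add_inv_lt_one hd).le

/-- Only finitely many `c` are allowed, so the strict gap in `mul_colWeight_lt` has a positive
minimum. -/
lemma exists_mul_colWeight_le {d : ℕ} (hd : 2 ≤ d) (C : ℕ) : ∃ δ : ℝ, 0 < δ ∧
    ∀ c ≤ C, c * colWeight d c ≤
      1 + (1 / d - rootStep d) * ((c : ℝ) - d) - if c ≠ d then δ else 0 := by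
  let F : ℕ → ℝ := fun c => 1 + (1 / d - rootStep d) * ((c : ℝ) - d) - c * colWeight d c
  obtain ⟨c₀, hc₀, hmin⟩ := Finset.exists_min_image ((Finset.range (C + 1)).filter (· ≠ d)) F
    ⟨0, by simp; omega⟩
  refine ⟨F c₀, sub_pos.2 (mul_colWeight_lt hd (Finset.mem_filter.1 hc₀).2), fun c hc => ?_⟩
  split_ifs with h
  · have := hmin c (Finset.mem_filter.2 ⟨Finset.mem_range.2 (by omega), h⟩)
    simp only [F] at this ⊢
    linarith
  · have h : c = d := not_not.1 h
    subst h
    have : (c : ℝ) ≠ 0 := by positivity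
    rw [colWeight_self (by omega)]; simp [this]

section Window

variable {d n : ℕ} {x : Fin n → ℕ} {σ : Equiv.Perm (Fin n)}

/-- A positive diagonal `σ` sends these rows injectively to columns at distance less than `d` from
the window, so a positive permanent alone controls how rows crowd together. -/
lemma card_rows_meeting_le (hσ : ∀ i, blockRel d x i (σ i)) (p q : ℕ) :
    (Finset.univ.filter fun i => p < x i + d ∧ x i < q).card ≤ q - p + 2 * d := by
  rw [← Finset.card_map σ.toEmbedding]
  refine le_trans (Finset.card_le_card ?_)
    ((card_fin_between_le (n := n) (p - d) (q + d)).trans (by omega))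
  intro k hk
  simp only [Finset.mem_map, Finset.mem_filter, Finset.mem_univ, true_and] at hk ⊢
  obtain ⟨i, hi, rfl⟩ := hk
  have := hσ i
  simp only [blockRel] at this
  simp only [Equiv.toEmbedding_apply]
  omega

lemma colSum_blockRel_le (hσ : ∀ i, blockRel d x i (σ i)) (k : Fin n) :
    colSum (blockRel d x) k ≤ 2 * d + 1 := by
  refine le_trans (Finset.card_le_card ?_)
    ((card_rows_meeting_le hσ (k : ℕ) (k + 1 : ℕ)).trans (by omega))
  intro i hi
  have hik : blockRel d x i k := (Finset.mem_filter.1 hi).2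
  simp only [Finset.mem_filter, Finset.mem_univ, true_and, blockRel] at hik ⊢
  omega

lemma le_card_rows_inside (hσ : ∀ i, blockRel d x i (σ i)) {c w : ℕ} (hcw : c + w ≤ n) :
    w ≤ (Finset.univ.filter fun i => c ≤ x i ∧ x i + d ≤ c + w).card + 2 * d := by
  have h := card_fin_between (n := n) (p := c + d) (q := c + w - d) (by omega)
  rw [← Finset.card_map σ.symm.toEmbedding] at h
  have h2 : (c + w - d) - (c + d) ≤
      (Finset.univ.filter fun i => c ≤ x i ∧ x i + d ≤ c + w).card := by
    rw [← h]
    apply Finset.card_le_card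
    intro i hi
    simp only [Finset.mem_map, Finset.mem_filter, Finset.mem_univ, true_and] at hi ⊢
    obtain ⟨k, hk, rfl⟩ := hi
    have := hσ (σ.symm k)
    simp only [blockRel, Equiv.apply_symm_apply] at this
    simp only [Equiv.toEmbedding_apply]
    omega
  omega

/-- A row with ones in the first and the last column of a block of length `d` has that very block.
-/
lemma skewRow_blockRel (hd : 2 ≤ d) {i : Fin n} (hx : x i + d ≤ n)
    (hreg : ∀ k, blockRel d x i k → colSum (blockRel d x) k = d)
    (hi : (Finset.univ.filter fun j => x j = x i).card < d) : SkewRow (blockRel d x) d i := by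
  refine ⟨hreg, ⟨x i + d - 1, by omega⟩, ⟨x i, by omega⟩, ?_, ?_, ?_, ?_⟩
  · simp only [blockRel]; omega
  · simp only [blockRel]; omega
  · simp only [ne_eq, Fin.mk.injEq]; omega
  · refine lt_of_le_of_lt (Finset.card_le_card ?_) hi
    intro j hj
    obtain ⟨h1, h2⟩ := (Finset.mem_filter.1 hj).2
    simp only [Finset.mem_filter, Finset.mem_univ, true_and, blockRel] at h1 h2 ⊢
    omega

end Window

/-- Every sufficiently long window of columns in which no block is repeated `d` times contains a
light or skew row. -/
theorem exists_light_or_skew_row {d : ℕ} (hd : 2 ≤ d) : ∃ θ : ℝ, θ < 1 ∧ ∃ w : ℕ,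
    ∀ (n : ℕ) (x : Fin n → ℕ) (σ : Equiv.Perm (Fin n)), (∀ i, x i + d ≤ n) →
      (∀ i, blockRel d x i (σ i)) → ∀ c, c + w ≤ n →
      (∀ i, c ≤ x i → x i + d ≤ c + w → (Finset.univ.filter fun j => x j = x i).card < d) →
      ∃ i, c ≤ x i ∧ x i + d ≤ c + w ∧
        (LightRow (blockRel d x) d θ i ∨ SkewRow (blockRel d x) d i) := by
  have hd0 : (0 : ℝ) < d := by positivity
  obtain ⟨δ, hδ, hcol⟩ := exists_mul_colWeight_le hd (2 * d + 1)
  set α : ℝ := 1 / d - rootStep d with hα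
  have hα0 : 0 ≤ α := sub_nonneg.2 (rootStep_le_inv (by omega))
  -- Each column meets at most `2d + 1` rows. If every row of the window meets a column of sum other
  -- than `d`, the column gaps `δ` therefore amount to at least `2η` per row, twice the deficit `η`
  -- allowed below.
  set η : ℝ := δ / (2 * (2 * d + 1)) with hη
  have hη0 : 0 < η := by positivity
  -- Chosen so that `η w` exceeds the boundary errors: `2d` rows missing from `Q` and the excess
  -- `2d²` of the column sums.
  obtain ⟨w, hw⟩ := exists_nat_gt ((2 * d * (1 + η) + 2 * α * d ^ 2) / η)
  rw [div_lt_iff₀ hη0] at hw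
  refine ⟨1 - η, by linarith, w, fun n x σ hx hσ c hcw hfree => ?_⟩
  by_contra! hcon
  set a := blockRel d x with ha
  set Q := Finset.univ.filter fun i => c ≤ x i ∧ x i + d ≤ c + w with hQ
  set K := Finset.univ.filter fun k : Fin n => c ≤ (k : ℕ) ∧ (k : ℕ) < c + w with hK
  set I := K.filter fun k => colSum a k ≠ d with hI
  have hKcard : K.card = w := by rw [hK, card_fin_between hcw]; omega
  have hQcard : w ≤ Q.card + 2 * d := le_card_rows_inside hσ hcw
  have hQK : ∀ i ∈ Q, ∀ k, a i k → k ∈ K := by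
    intro i hi k hk
    simp only [hQ, hK, ha, blockRel, Finset.mem_filter, Finset.mem_univ, true_and] at hi hk ⊢
    omega
  have hQI : Q.card ≤ I.card * (2 * d + 1) := by
    have hsub : Q ⊆ I.biUnion fun k => Finset.univ.filter (a · k) := by
      intro i hi
      obtain ⟨h1, h2⟩ : c ≤ x i ∧ x i + d ≤ c + w := by simpa [hQ] using hi
      have : ∃ k, a i k ∧ colSum a k ≠ d := by
        by_contra! hreg
        exact (hcon i h1 h2).2 (skewRow_blockRel hd (hx i) hreg (hfree i h1 h2))
      obtain ⟨k, hk, hkd⟩ := this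
      exact Finset.mem_biUnion.2 ⟨k, Finset.mem_filter.2 ⟨hQK i hi k hk, hkd⟩, by simpa using hk⟩
    refine (Finset.card_le_card hsub).trans (Finset.card_biUnion_le_card_mul _ _ _ fun k _ => ?_)
    exact colSum_blockRel_le hσ k
  have hsumcol : ∑ k ∈ K, colSum a k ≤ (w + 2 * d) * d := by
    set Z := Finset.univ.filter fun i => c < x i + d ∧ x i < c + w with hZ
    have hZcard : Z.card ≤ w + 2 * d := (card_rows_meeting_le hσ c (c + w)).trans (by omega)
    have h1 : ∀ k ∈ K, colSum a k = (Z.filter (a · k)).card := by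
      intro k hk
      unfold colSum
      congr 1
      ext i
      simp only [hZ, hK, ha, blockRel, Finset.mem_filter, Finset.mem_univ, true_and] at hk ⊢
      omega
    rw [Finset.sum_congr rfl h1]
    have h2 := Finset.sum_card_bipartiteAbove_eq_sum_card_bipartiteBelow a (s := Z) (t := K)
    simp only [Finset.bipartiteAbove, Finset.bipartiteBelow] at h2
    rw [← h2]
    refine (Finset.sum_le_card_nsmul Z _ d fun i _ => ?_).trans ?_
    · exact (Finset.card_le_card (Finset.filter_subset_filter _ (Finset.subset_univ _))).trans
        (rowSum_blockRel (hx i)).le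
    · rw [smul_eq_mul]; exact Nat.mul_le_mul_right _ hZcard
  -- Double counting of the weights: no row is light, and each column of sum `c` is counted at most
  -- `c` times.
  have hlower : (1 - η) * Q.card ≤ ∑ k ∈ K, colSum a k * colWeight d (colSum a k) := by
    calc (1 - η) * Q.card = ∑ i ∈ Q, (1 - η) := by rw [Finset.sum_const, nsmul_eq_mul]; ring
      _ ≤ ∑ i ∈ Q, ∑ k ∈ K, if a i k then colWeight d (colSum a k) else 0 := by
        refine Finset.sum_le_sum fun i hi => ?_
        obtain ⟨h1, h2⟩ : c ≤ x i ∧ x i + d ≤ c + w := by simpa [hQ] using hi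
        have h3 := (hcon i h1 h2).1
        rw [LightRow, not_le] at h3
        rw [← Finset.sum_filter]
        refine h3.le.trans (le_of_eq (Finset.sum_congr ?_ fun _ _ => rfl))
        ext k
        simp only [Finset.mem_filter, Finset.mem_univ, true_and]
        exact ⟨fun hk => ⟨hQK i hi k hk, hk⟩, fun hk => hk.2⟩
      _ = ∑ k ∈ K, ∑ i ∈ Q, if a i k then colWeight d (colSum a k) else 0 := Finset.sum_comm
      _ ≤ _ := by
        refine Finset.sum_le_sum fun k _ => ?_
        rw [← Finset.sum_filter, Finset.sum_const, nsmul_eq_mul]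
        refine mul_le_mul_of_nonneg_right ?_ (Real.exp_pos _).le
        exact_mod_cast Finset.card_le_card (Finset.filter_subset_filter _ (Finset.subset_univ _))
  have hupper : ∑ k ∈ K, (colSum a k * colWeight d (colSum a k) : ℝ) ≤
      w + α * (2 * d ^ 2) - δ * I.card := by
    refine (Finset.sum_le_sum fun k _ => hcol _ (colSum_blockRel_le hσ k)).trans ?_
    rw [Finset.sum_sub_distrib, Finset.sum_add_distrib, ← Finset.mul_sum, Finset.sum_sub_distrib,
      Finset.sum_const, Finset.sum_const, ← Finset.sum_filter, Finset.sum_const, ← hI, hKcard]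
    simp only [nsmul_eq_mul, mul_one]
    have h1 : ∑ k ∈ K, (colSum a k : ℝ) ≤ (w + 2 * d) * d := by exact_mod_cast hsumcol
    have h2 := mul_le_mul_of_nonneg_left (show ∑ k ∈ K, (colSum a k : ℝ) - w * d ≤ 2 * d ^ 2 by
      linarith) hα0
    linarith
  have h1 : (Q.card : ℝ) ≤ I.card * (2 * d + 1) := by exact_mod_cast hQI
  have h2 : (w : ℝ) ≤ Q.card + 2 * d := by exact_mod_cast hQcard
  have h3 : 2 * η * Q.card ≤ δ * I.card := by
    calc 2 * η * Q.card ≤ 2 * η * (I.card * (2 * d + 1)) :=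
          mul_le_mul_of_nonneg_left h1 (by positivity)
      _ = δ * I.card := by rw [hη]; field_simp
  have h4 : (1 + η) * w ≤ (1 + η) * (Q.card + 2 * d) :=
    mul_le_mul_of_nonneg_left h2 (by positivity)
  linarith

/-! ### Comparison with a direct sum of all-ones blocks -/

/-- A matrix with a long window of columns in which no block is repeated `d` times has permanent
smaller than that of a direct sum of all-ones blocks. -/
theorem exists_subPer_lt_pow {d : ℕ} (hd : 2 ≤ d) : ∃ b : ℕ,
    ∀ (n : ℕ) (x : Fin n → ℕ), (∀ i, x i + d ≤ n) → ∀ c m, c + m ≤ n → b ≤ m →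
      (∀ i, c ≤ x i → x i + d ≤ c + m → (Finset.univ.filter fun j => x j = x i).card < d) →
      subPer (blockRel d x) Finset.univ Finset.univ < d.factorial ^ (n / d) := by
  have hd0 : (0 : ℝ) < d := by positivity
  obtain ⟨θ₁, hθ₁, w, hwin⟩ := exists_light_or_skew_row hd
  obtain ⟨θ₂, hθ₂, hmix⟩ := exists_mixedWeight_le (D := d - 1) (by omega)
  set θ := max (max θ₁ ((d - 1 + θ₂) / d)) 0 with hθdef
  have hθ1 : θ < 1 := by
    refine max_lt (max_lt hθ₁ ?_) one_pos
    rw [div_lt_one hd0]; linarith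
  have hθ0 : 0 ≤ θ := le_max_right _ _
  have hfac : (0 : ℝ) < d.factorial := by exact_mod_cast d.factorial_pos
  obtain ⟨s, hs⟩ := exists_pow_lt_of_lt_one (one_div_pos.2 hfac) hθ1
  -- There is room for `s` windows of length `w` separated by gaps `3d`, which put the chosen rows
  -- far apart; `θ ^ s < 1 / d!` pays for rounding `n / d` down.
  refine ⟨s * (w + 3 * d), fun n x hx c m hcm hbm hfree => ?_⟩
  rcases Nat.eq_zero_or_pos (subPer (blockRel d x) Finset.univ Finset.univ) with h0 | hpos
  · rw [h0]; exact pow_pos d.factorial_pos _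
  obtain ⟨f, hf⟩ := Finset.card_pos.1 hpos
  obtain ⟨-, hf2, hf3⟩ := mem_matchings.1 hf
  have hinj : Function.Injective f := fun i j h => hf3 (by simp) (by simp) h
  set σ : Equiv.Perm (Fin n) := Equiv.ofBijective f (Finite.injective_iff_bijective.1 hinj)
  have hσ : ∀ i, blockRel d x i (σ i) := fun i => (hf2 i (Finset.mem_univ i)).2
  have hwin' : ∀ t : Fin s, ∃ i, c + t * (w + 3 * d) ≤ x i ∧ x i + d ≤ c + t * (w + 3 * d) + w ∧
      (LightRow (blockRel d x) d θ i ∨ SkewRow (blockRel d x) d i) := by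
    intro t
    have ht : (t + 1) * (w + 3 * d) ≤ s * (w + 3 * d) := Nat.mul_le_mul_right _ t.2
    rw [add_mul] at ht
    obtain ⟨i, h1, h2, h3⟩ := hwin n x σ hx hσ (c + t * (w + 3 * d)) (by omega)
      (fun i h1 h2 => hfree i (by omega) (by omega))
    exact ⟨i, h1, h2, h3.imp_left fun h => h.trans ((le_max_left _ _).trans (le_max_left _ _))⟩
  choose i hi1 hi2 hi3 using hwin'
  have hsep : ∀ t t' : Fin s, t < t' → x (i t) + 4 * d ≤ x (i t') := by
    intro t t' h
    have ht : ((t : ℕ) + 1) * (w + 3 * d) ≤ t' * (w + 3 * d) := Nat.mul_le_mul_right _ h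
    rw [add_mul] at ht
    have := hi2 t
    have := hi1 t'
    omega
  have hinj : Function.Injective i := by
    intro t t' h
    rcases lt_trichotomy t t' with hlt | heq | hlt
    · have := hsep _ _ hlt; rw [h] at this; omega
    · exact heq
    · have := hsep _ _ hlt; rw [h] at this; omega
  have hbound := subPer_le_pow_mul hd (fun j => rowSum_blockRel (hx j)) hθ0 hmix
    ((le_max_right _ _).trans (le_max_left _ _)) (Finset.univ.map ⟨i, hinj⟩)
    (fun j hj => by
      obtain ⟨t, -, rfl⟩ := Finset.mem_map.1 hj
      exact hi3 t)
    (fun j hj j' hj' hne => by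
      obtain ⟨t, -, rfl⟩ := Finset.mem_map.1 hj
      obtain ⟨t', -, rfl⟩ := Finset.mem_map.1 hj'
      have htt : t ≠ t' := fun h => hne (by rw [h])
      intro p p' k k' l
      simp only [blockRel, Function.Embedding.coeFn_mk]
      rcases htt.lt_or_gt with h | h
      · have := hsep _ _ h
        omega
      · have := hsep _ _ h
        omega)
    Finset.univ Finset.univ rfl (fun _ _ _ _ _ _ => ⟨Finset.mem_univ _, fun _ _ => Finset.mem_univ _⟩)
  rw [Finset.card_map, Finset.card_univ, Fintype.card_fin] at hbound
  have hlog : logBound (blockRel d x) Finset.univ Finset.univ = n * logRoot d := by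
    rw [logBound, Finset.sum_congr rfl fun j _ => by rw [rowSum_blockRel (hx j)],
      Finset.sum_const, nsmul_eq_mul, Finset.card_univ, Fintype.card_fin]
  have hexp : Real.exp (n * logRoot d) ≤ (d.factorial : ℝ) ^ (n / d + 1) := by
    rw [← Real.exp_log (pow_pos hfac (n / d + 1)), Real.exp_le_exp, Real.log_pow, logRoot]
    have h1 : (n : ℝ) ≤ ((n / d + 1 : ℕ) : ℝ) * d := by
      exact_mod_cast (Nat.lt_div_mul_add (show 0 < d by omega)).le.trans (by rw [add_mul, one_mul])
    have h2 : 0 ≤ Real.log (d.factorial : ℝ) :=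
      Real.log_nonneg (by exact_mod_cast d.factorial_pos)
    calc (n : ℝ) * (Real.log d.factorial / d) = n / d * Real.log d.factorial := by ring
      _ ≤ _ := mul_le_mul_of_nonneg_right (by rwa [div_le_iff₀ hd0]) h2
  rw [hlog] at hbound
  have : (subPer (blockRel d x) Finset.univ Finset.univ : ℝ) < (d.factorial : ℝ) ^ (n / d) := by
    calc _ ≤ _ := hbound
      _ ≤ θ ^ s * (d.factorial : ℝ) ^ (n / d + 1) :=
        mul_le_mul_of_nonneg_left hexp (pow_nonneg hθ0 _)
      _ < 1 / d.factorial * (d.factorial : ℝ) ^ (n / d + 1) :=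
        mul_lt_mul_of_pos_right hs (by positivity)
      _ = _ := by rw [pow_succ]; field_simp
  exact_mod_cast this

lemma permanent_eq_card {n d : ℕ} {A : Matrix (Fin n) (Fin n) ℕ} {x : Fin n → ℕ}
    (hA : ∀ i j, A i j = if blockRel d x i j then 1 else 0) :
    A.permanent =
      (Finset.univ.filter fun σ : Equiv.Perm (Fin n) => ∀ i, blockRel d x i (σ i)).card := by
  rw [← Matrix.permanent_transpose, Matrix.permanent, Finset.card_filter]
  refine Finset.sum_congr rfl fun σ _ => ?_
  simp only [Matrix.transpose_apply, hA]
  rw [Finset.prod_ite_zero]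
  simp

lemma permanent_le_subPer {n d : ℕ} {A : Matrix (Fin n) (Fin n) ℕ} {x : Fin n → ℕ}
    (hA : ∀ i j, A i j = if blockRel d x i j then 1 else 0) :
    A.permanent ≤ subPer (blockRel d x) Finset.univ Finset.univ := by
  rw [permanent_eq_card hA]
  refine Finset.card_le_card_of_injOn (fun σ => ⇑σ) (fun σ hσ => ?_)
    (fun σ _ τ _ h => DFunLike.coe_injective h)
  have hσ : ∀ i, blockRel d x i (σ i) := (Finset.mem_filter.1 hσ).2
  rw [Finset.mem_coe, mem_matchings]
  exact ⟨by simp, by simpa using hσ, σ.injective.injOn⟩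

/-- The matrix `1_{d×d} ⊕ ⋯ ⊕ 1_{d×d}`, completed by rows that end in the last column, has permanent
at least `(d!)^⌊n/d⌋`. -/
lemma exists_gamma_pow_le_permanent {n d : ℕ} (hd : 1 ≤ d) (hdn : d ≤ n) :
    ∃ B ∈ Gamma n d, d.factorial ^ (n / d) ≤ B.permanent := by
  set y : Fin n → ℕ := fun i => if (i : ℕ) < n / d * d then d * ((i : ℕ) / d) else n - d with hy
  set B : Matrix (Fin n) (Fin n) ℕ := fun i j => if blockRel d y i j then 1 else 0 with hB
  have hn : n / d * d + n % d = n := Nat.div_add_mod' n d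
  have hmod : n % d < d := Nat.mod_lt n hd
  refine ⟨B, fun i => ⟨y i, ?_, fun j => rfl⟩, ?_⟩
  · simp only [hy]
    split_ifs with h
    · have h1 : (i : ℕ) / d < n / d := (Nat.div_lt_iff_lt_mul hd).2 h
      have h2 : d * ((i : ℕ) / d + 1) ≤ d * (n / d) := Nat.mul_le_mul_left d h1
      rw [mul_add, mul_one, mul_comm d (n / d)] at h2
      omega
    · omega
  · rw [permanent_eq_card (d := d) (x := y) fun i j => rfl]
    -- Permuting within the diagonal blocks and fixing the last `n % d` indices gives the
    -- `(d!)^⌊n/d⌋` diagonals; the completing rows have a one on the main diagonal since they end in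
    -- the last column.
    let E : (Fin (n / d) × Fin d) ⊕ Fin (n % d) ≃ Fin n :=
      ((Equiv.sumCongr finProdFinEquiv (Equiv.refl _)).trans finSumFinEquiv).trans (finCongr hn)
    have hE1 : ∀ p t, (E (Sum.inl (p, t)) : ℕ) = t + d * p := fun p t => by
      simp [E, finProdFinEquiv]
    have hE2 : ∀ t, (E (Sum.inr t) : ℕ) = n / d * d + t := fun t => by simp [E]
    let Φ : (Fin (n / d) → Equiv.Perm (Fin d)) → Equiv.Perm (Fin n) := fun g =>
      (E.symm.trans (Equiv.sumCongr (Equiv.prodCongrRight g) (Equiv.refl _))).trans E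
    have hΦ : Function.Injective Φ := by
      intro g g' h
      funext p
      ext t
      have := congrArg (fun σ : Equiv.Perm (Fin n) => E.symm (σ (E (Sum.inl (p, t))))) h
      simp only [Φ, Equiv.trans_apply, Equiv.symm_apply_apply, Equiv.sumCongr_apply, Sum.map_inl,
        Equiv.prodCongrRight_apply, Sum.inl.injEq, Prod.mk.injEq, true_and] at this
      rw [this]
    have hcard : (Finset.univ : Finset (Fin (n / d) → Equiv.Perm (Fin d))).card =
        d.factorial ^ (n / d) := by
      simp [Fintype.card_perm]
    rw [← hcard]
    refine Finset.card_le_card_of_injOn Φ (fun g _ => ?_) hΦ.injOn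
    simp only [Finset.coe_filter, Finset.mem_univ, true_and, Set.mem_ofPred_eq]
    intro i
    obtain ⟨z, rfl⟩ := E.surjective i
    rcases z with ⟨p, t⟩ | t
    · have h1 : Φ g (E (Sum.inl (p, t))) = E (Sum.inl (p, g p t)) := by simp [Φ]
      have h2 : d * ((p : ℕ) + 1) ≤ d * (n / d) := Nat.mul_le_mul_left d p.2
      rw [mul_add, mul_one, mul_comm d (n / d)] at h2
      have h3 : y (E (Sum.inl (p, t))) = d * p := by
        simp only [hy, hE1]
        rw [if_pos (by have := t.2; omega), Nat.add_mul_div_left _ _ hd,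
          Nat.div_eq_of_lt t.2, zero_add]
      rw [blockRel, h1, h3, hE1]
      have := (g p t).2
      omega
    · have h1 : Φ g (E (Sum.inr t)) = E (Sum.inr t) := by simp [Φ]
      have h3 : y (E (Sum.inr t)) = n - d := by
        simp only [hy, hE2]
        rw [if_neg (by omega)]
      rw [blockRel, h1, h3, hE2]
      have := t.2
      omega

/-! ### Components and the windows they occupy -/

/-- The graph of a fully indecomposable `(0,1)`-matrix is connected. -/
lemma FullyIndecomposable.connected {m : ℕ} {C : Matrix (Fin m) (Fin m) ℕ}
    (h : FullyIndecomposable C) (h01 : ∀ i j, C i j = 0 ∨ C i j = 1) :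
    (bipGraph C).Connected := by
  classical
  obtain ⟨hm, hz⟩ := h
  set v : Fin m ⊕ Fin m := Sum.inl ⟨0, hm⟩ with hv
  set X := Finset.univ.filter fun s => (bipGraph C).Reachable v (Sum.inl s) with hX
  set Y := Finset.univ.filter fun t => (bipGraph C).Reachable v (Sum.inr t) with hY
  have hadj : ∀ s t, C s t = 1 → (bipGraph C).Adj (Sum.inl s) (Sum.inr t) := fun s t hst =>
    (SimpleGraph.fromRel_adj _ _ _).2 ⟨by simp, Or.inl ⟨s, t, rfl, rfl, hst⟩⟩
  have hX0 : X.Nonempty := ⟨⟨0, hm⟩, by simp [hX, hv]⟩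
  -- The zero blocks `X × Yᶜ` and `Xᶜ × Y` have dimensions summing to `2m`, so they cannot both
  -- satisfy `r + s < m`.
  have hXY : ∀ s ∈ X, ∀ t ∈ Yᶜ, C s t = 0 := fun s hs t ht =>
    (h01 s t).resolve_right fun hst => by
      simp only [hX, hY, Finset.mem_compl, Finset.mem_filter, Finset.mem_univ, true_and] at hs ht
      exact ht (hs.trans (hadj s t hst).reachable)
  have hYX : ∀ s ∈ Xᶜ, ∀ t ∈ Y, C s t = 0 := fun s hs t ht =>
    (h01 s t).resolve_right fun hst => by
      simp only [hX, hY, Finset.mem_compl, Finset.mem_filter, Finset.mem_univ, true_and] at hs ht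
      exact hs (ht.trans (hadj s t hst).symm.reachable)
  have hXc : X.card + Xᶜ.card = m := by rw [Finset.card_add_card_compl, Fintype.card_fin]
  have hYc : Y.card + Yᶜ.card = m := by rw [Finset.card_add_card_compl, Fintype.card_fin]
  have hX1 := Finset.card_pos.2 hX0
  have hYu : Yᶜ.card = 0 := by
    by_contra hne
    have h1 := hz X Yᶜ hX0 (Finset.card_pos.1 (by omega)) hXY
    have h2 := hz Xᶜ Y (Finset.card_pos.1 (by omega)) (Finset.card_pos.1 (by omega)) hYX
    omega
  have hXu : Xᶜ.card = 0 := by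
    by_contra hne
    have h2 := hz Xᶜ Y (Finset.card_pos.1 (by omega)) (Finset.card_pos.1 (by omega)) hYX
    omega
  rw [Finset.card_eq_zero, Finset.compl_eq_empty_iff] at hYu hXu
  refine (SimpleGraph.connected_iff_exists_forall_reachable _).2 ⟨v, ?_⟩
  rintro (s | t)
  · exact (Finset.mem_filter.1 (hXu ▸ Finset.mem_univ s : s ∈ X)).2
  · exact (Finset.mem_filter.1 (hYu ▸ Finset.mem_univ t : t ∈ Y)).2

section DirectSum

variable {n k d : ℕ} {A : Matrix (Fin n) (Fin n) ℕ} {x : Fin n → ℕ} {m : Fin k → ℕ}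
  {C : ∀ i, Matrix (Fin (m i)) (Fin (m i)) ℕ} {e f : (Σ i, Fin (m i)) ≃ Fin n}

lemma apply_same_block (hsum : A.submatrix e f = Matrix.blockDiagonal' C) (i : Fin k)
    (s t : Fin (m i)) : A (e ⟨i, s⟩) (f ⟨i, t⟩) = C i s t := by
  have := congrFun (congrFun hsum ⟨i, s⟩) ⟨i, t⟩
  rwa [Matrix.submatrix_apply, Matrix.blockDiagonal'_apply_eq] at this

lemma same_block_of_rel (hsum : A.submatrix e f = Matrix.blockDiagonal' C)
    (hA : ∀ i j, A i j = if blockRel d x i j then 1 else 0) {i j : Fin k} {s : Fin (m i)}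
    {t : Fin (m j)} (h : blockRel d x (e ⟨i, s⟩) (f ⟨j, t⟩)) : i = j := by
  by_contra hij
  have := congrFun (congrFun hsum ⟨i, s⟩) ⟨j, t⟩
  rw [Matrix.submatrix_apply, Matrix.blockDiagonal'_apply_ne C s t hij, hA, if_pos h] at this
  exact one_ne_zero this

/-- The columns of a connected component are contiguous. -/
lemma columns_convex (hsum : A.submatrix e f = Matrix.blockDiagonal' C)
    (hA : ∀ i j, A i j = if blockRel d x i j then 1 else 0) {i : Fin k}
    (hconn : (bipGraph (C i)).Connected) {t t' : Fin (m i)} {q : ℕ}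
    (h1 : (f ⟨i, t⟩ : ℕ) ≤ q) (h2 : q ≤ (f ⟨i, t'⟩ : ℕ)) : ∃ s, (f ⟨i, s⟩ : ℕ) = q := by
  by_contra! hq
  have hqn : q < n := h2.trans_lt (f ⟨i, t'⟩).2
  obtain ⟨⟨j, s⟩, hs⟩ := f.surjective ⟨q, hqn⟩
  have hsq : (f ⟨j, s⟩ : ℕ) = q := by rw [hs]
  have hji : i ≠ j := by rintro rfl; exact hq s hsq
  -- Column `q` belongs to another component, so no row of this one covers it; each row lies wholly
  -- on one side of `q`, and the side is constant along edges.
  let side : Fin (m i) ⊕ Fin (m i) → Prop :=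
    Sum.elim (fun s => x (e ⟨i, s⟩) < q) (fun t => (f ⟨i, t⟩ : ℕ) < q)
  have hrel : ∀ s t, C i s t = 1 → (side (Sum.inl s) ↔ side (Sum.inr t)) := by
    intro s' t' hst
    have h3 : blockRel d x (e ⟨i, s'⟩) (f ⟨i, t'⟩) := by
      by_contra hc
      rw [← apply_same_block hsum, hA, if_neg hc] at hst
      exact zero_ne_one hst
    have h4 : ¬ blockRel d x (e ⟨i, s'⟩) (f ⟨j, s⟩) := fun h => hji (same_block_of_rel hsum hA h)
    have h5 := hq t'
    simp only [blockRel, hsq] at h3 h4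
    simp only [side, Sum.elim_inl, Sum.elim_inr]
    omega
  have hadj : ∀ v w, (bipGraph (C i)).Adj v w → (side v ↔ side w) := by
    intro v w hvw
    rcases ((SimpleGraph.fromRel_adj _ _ _).1 hvw).2 with ⟨s, t, rfl, rfl, h⟩ | ⟨s, t, rfl, rfl, h⟩
    · exact hrel s t h
    · exact (hrel s t h).symm
  have hreach : ∀ v w, (bipGraph (C i)).Reachable v w → (side v ↔ side w) := by
    rintro v w ⟨p⟩
    induction p with
    | nil => exact Iff.rfl
    | cons h _ ih => exact (hadj _ _ h).trans ih
  have h3 := hreach _ _ (hconn.preconnected (Sum.inr t) (Sum.inr t'))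
  simp only [side, Sum.elim_inr] at h3
  have h4 := hq t
  have h5 := hq t'
  omega

/-- The columns of a connected component form a window, and if the component does not contain
`1_{d×d}`, then no block in this window is repeated `d` times. -/
lemma exists_window (hd : 1 ≤ d) (hsum : A.submatrix e f = Matrix.blockDiagonal' C)
    (hA : ∀ i j, A i j = if blockRel d x i j then 1 else 0) {i : Fin k}
    (hconn : (bipGraph (C i)).Connected) (hC : ¬ ContainsOnes d (C i)) :
    ∃ c, c + m i ≤ n ∧ (∀ t, c ≤ (f ⟨i, t⟩ : ℕ) ∧ (f ⟨i, t⟩ : ℕ) < c + m i) ∧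
      ∀ j, c ≤ x j → x j + d ≤ c + m i → (Finset.univ.filter fun j' => x j' = x j).card < d := by
  set T : Finset ℕ := Finset.univ.image fun t => (f ⟨i, t⟩ : ℕ) with hT
  have hTne : T.Nonempty := by
    obtain ⟨v⟩ := hconn.nonempty
    rcases v with t | t <;> exact ⟨_, Finset.mem_image_of_mem _ (Finset.mem_univ t)⟩
  have hTcard : T.card = m i := by
    rw [hT, Finset.card_image_of_injective, Finset.card_univ, Fintype.card_fin]
    intro t t' h
    simpa using f.injective (Fin.ext h)
  have hTmem : ∀ q, q ∈ T ↔ ∃ t, (f ⟨i, t⟩ : ℕ) = q := fun q => by simp [hT]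
  obtain ⟨t₀, ht₀⟩ := (hTmem _).1 (T.min'_mem hTne)
  obtain ⟨t₁, ht₁⟩ := (hTmem _).1 (T.max'_mem hTne)
  have hIcc : T = Finset.Icc (T.min' hTne) (T.max' hTne) := by
    ext q
    rw [Finset.mem_Icc]
    refine ⟨fun hq => ⟨T.min'_le q hq, T.le_max' q hq⟩, fun ⟨h1, h2⟩ => (hTmem q).2 ?_⟩
    exact columns_convex hsum hA hconn (ht₀.trans_le h1) (h2.trans_eq ht₁.symm)
  have hm : m i = T.max' hTne + 1 - T.min' hTne := by
    rw [← hTcard]; conv_lhs => rw [hIcc]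
    exact Nat.card_Icc _ _
  have hle : T.min' hTne ≤ T.max' hTne := T.min'_le_max' hTne
  set c := T.min' hTne with hc
  have hwin : ∀ q, c ≤ q → q < c + m i → ∃ t, (f ⟨i, t⟩ : ℕ) = q := fun q h1 h2 =>
    (hTmem q).1 (by rw [hIcc, Finset.mem_Icc]; omega)
  refine ⟨c, ?_, fun t => ?_, fun j hj1 hj2 => ?_⟩
  · have := (f ⟨i, t₁⟩).2
    omega
  · have : (f ⟨i, t⟩ : ℕ) ∈ T := (hTmem _).2 ⟨t, rfl⟩
    rw [hIcc, Finset.mem_Icc] at this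
    omega
  · by_contra! hcard
    apply hC
    set J := Finset.univ.filter fun j' => x j' = x j with hJ
    let g := J.orderEmbOfCardLe hcard
    have hg : ∀ p, x (g p) = x j := fun p =>
      (Finset.mem_filter.1 (Finset.orderEmbOfCardLe_mem J hcard p)).2
    have hcol : ∀ p : Fin d, ∃ t, (f ⟨i, t⟩ : ℕ) = x j + p := fun p =>
      hwin _ (by omega) (by have := p.2; omega)
    choose cc hcc using hcol
    -- A row whose block lies in the window meets a column of the component and hence belongs to it.
    have hrow : ∀ p : Fin d, ∃ s, e ⟨i, s⟩ = g p := fun p => by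
      obtain ⟨⟨i', s⟩, hs⟩ := e.surjective (g p)
      have hr : blockRel d x (e ⟨i', s⟩) (f ⟨i, cc ⟨0, hd⟩⟩) := by
        rw [hs]; simp only [blockRel, hg, hcc]; omega
      obtain rfl := same_block_of_rel hsum hA hr
      exact ⟨s, hs⟩
    choose rr hrr using hrow
    refine ⟨⟨rr, fun p p' h => g.injective ?_⟩, ⟨cc, fun p p' h => ?_⟩, fun p p' => ?_⟩
    · rw [← hrr, ← hrr, h]
    · have h1 := hcc p
      have h2 := hcc p'
      rw [h] at h1
      exact Fin.ext (by omega)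
    · change C i (rr p) (cc p') = 1
      rw [← apply_same_block hsum, hA, if_pos]
      rw [hrr]
      have := p'.2
      simp only [blockRel, hg, hcc]
      omega

end DirectSum

/-- The bound for connected components. -/
theorem exists_connected_component_bound (d : ℕ) : ∃ b : ℕ,
    ∀ (n : ℕ) (A : Matrix (Fin n) (Fin n) ℕ), A ∈ Maximizing n d →
      ∀ (k : ℕ) (m : Fin k → ℕ) (C : ∀ i, Matrix (Fin (m i)) (Fin (m i)) ℕ),
        IsDirectSum A m C → ∀ i, (bipGraph (C i)).Connected →
          ¬ ContainsOnes d (C i) → m i ≤ b := by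
  rcases Nat.eq_zero_or_pos d with rfl | hd
  -- For `d = 0` the empty submatrix is always present.
  · refine ⟨0, fun n A _ k m C _ i _ hC => absurd ?_ hC⟩
    exact ⟨⟨Fin.elim0, fun p => p.elim0⟩, ⟨Fin.elim0, fun p => p.elim0⟩, fun p => p.elim0⟩
  rcases Nat.eq_or_lt_of_le hd with h1 | h2
  -- For `d = 1` any single one is a `1_{d×d}`, and every row of a component contains one.
  · refine ⟨0, fun n A hA k m C ⟨e, f, hsum⟩ i hconn hC => ?_⟩
    choose x hx hAx using hA.1
    obtain ⟨c, hcn, hcol, hfree⟩ := exists_window hd hsum (x := x) hAx hconn hC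
    by_contra! hm
    set j := e ⟨i, ⟨0, hm⟩⟩ with hj
    obtain ⟨⟨i', t⟩, ht⟩ := f.surjective ⟨x j, by have := hx j; omega⟩
    have hrel : blockRel d x j (f ⟨i', t⟩) := by rw [ht]; simp only [blockRel]; omega
    obtain rfl := same_block_of_rel hsum hAx hrel
    have h3 : c ≤ x j ∧ x j < c + m i := by simpa only [ht] using hcol t
    have h4 := hfree j h3.1 (by omega)
    have h5 : 0 < (Finset.univ.filter fun j' => x j' = x j).card :=
      Finset.card_pos.2 ⟨j, by simp⟩
    omega
  · obtain ⟨b, hb⟩ := exists_subPer_lt_pow h2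
    refine ⟨b, fun n A hA k m C ⟨e, f, hsum⟩ i hconn hC => ?_⟩
    choose x hx hAx using hA.1
    obtain ⟨c, hcn, hcol, hfree⟩ := exists_window hd hsum (x := x) hAx hconn hC
    by_contra! hm
    have hdn : d ≤ n := by
      have h0 : 0 < n := by omega
      have := hx ⟨0, h0⟩
      omega
    obtain ⟨B, hB, hBper⟩ := exists_gamma_pow_le_permanent hd hdn
    have h3 := hb n x hx c (m i) hcn hm.le hfree
    have h4 := permanent_le_subPer (A := A) (x := x) (d := d) hAx
    have h5 := hA.2 B hB
    omega

end ContigPerm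

theorem theorem3p6 (d : ℕ) :
    ∃ b : ℕ, ∀ (n : ℕ) (A : Matrix (Fin n) (Fin n) ℕ), A ∈ ContigPerm.Maximizing n d →
      (∀ (k : ℕ) (m : Fin k → ℕ) (C : ∀ i, Matrix (Fin (m i)) (Fin (m i)) ℕ),
        ContigPerm.IsComponents A m C →
          ∀ i, ¬ ContigPerm.ContainsOnes d (C i) → m i ≤ b) ∧
      (∀ (k : ℕ) (m : Fin k → ℕ) (C : ∀ i, Matrix (Fin (m i)) (Fin (m i)) ℕ),
        ContigPerm.IsConnectedComponents A m C →
          ∀ i, ¬ ContigPerm.ContainsOnes d (C i) → m i ≤ b) := by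
  obtain ⟨b, hb⟩ := ContigPerm.exists_connected_component_bound d
  refine ⟨b, fun n A hA => ⟨fun k m C hC i hi => ?_, fun k m C hC i hi => ?_⟩⟩
  · refine hb n A hA k m C hC.1 i ((hC.2 i).connected fun s t => ?_) hi
    obtain ⟨e, f, hsum⟩ := hC.1
    obtain ⟨x, -, hx⟩ := hA.1 (e ⟨i, s⟩)
    rw [← ContigPerm.apply_same_block hsum, hx]
    split_ifs <;> simp
  · exact hb n A hA k m C hC.1 i (hC.2 i) hi
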